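/- Let $\mathbf A\in L^2_{\rm loc}(\mathbb R^3;\mathbb R^3)$ be a magnetic potential with field $\mathbf B=\operatorname{curl}\mathbf A$. For $N\ge 1$ and $Z>0$ let $$H_{N,Z,\mathbf A}=\sum_{i=1}^N\Big(\big[\boldsymbol\sigma_i\cdot(-i\nabla_i+\mathbf A(\mathbf x_i))\big]^2-\frac{Z}{|\mathbf x_i|}\Big)+\sum_{i<j}\frac1{|\mathbf x_i-\mathbf x_j|}$$ be the Pauli Hamiltonian of $N$ spin-$\frac12$ particles, where $\boldsymbol\sigma$ are the Pauli matrices, so that $[\boldsymbol\sigma\cdot(-i\nabla+\mathbf A)]^2=(-i\nabla+\mathbf A)^2+\mathbf B\cdot\boldsymbol\sigma$ includes the spin-field coupling. It acts on the bosonic subspace of $\bigotimes^N L^2(\mathbb R^3;\mathbb C^2)$, or on the fermionic subspace, or on the whole space (no symmetry), the choice being the same for all $N$; it is defined as the operator associated with the closure of its quadratic form on the smooth compactly supported functions with the given symmetry. Assume that for all $N\ge1$ and all charges $Z>0$ this quadratic form is bounded below, i.e. that the ground state energy $$E(N,Z,\mathbf B)=\inf\operatorname{spec}H_{N,Z,\mathbf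 A}$$ is finite. Fix $Z>0$ and assume that $E(N,Z,\mathbf B)$ is (weakly) decreasing in $N\ge 1$. Then the set of $N\ge1$ for which $E(N,Z,\mathbf B)$ is an eigenvalue of $H_{N,Z,\mathbf A}$ is bounded above, and if $N_c$ denotes its largest element (supposing the set is non-empty), then for every $k>1$ $$N_c<2Z+1+\frac12\,\frac{E(N_c,Z,\mathbf B)-E(N_c,kZ,\mathbf B)}{N_cZ(k-1)}.$$ -/

import Mathlib

open MeasureTheory Filter Topology
open scoped ContDiff

noncomputable section

namespace PauliAtom

/-- Physical space `ℝ³`. -/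
abbrev Space : Type := EuclideanSpace ℝ (Fin 3)

/-- Positions of `N` particles. -/
abbrev Config (N : ℕ) : Type := Fin N → Space

/-- Spin space `(ℂ²)^{⊗N}`, in the product basis indexed by `Fin N → Fin 2`. -/
abbrev Spin (N : ℕ) : Type := EuclideanSpace ℂ (Fin N → Fin 2)

/-- `L²(ℝ³; ℂ²)^{⊗N} = L²((ℝ³)^N; (ℂ²)^{⊗N})`. -/
abbrev L2 (N : ℕ) : Type := Lp (Spin N) 2 (volume : Measure (Config N))

/-- The symmetry imposed on the wave functions: bosonic, fermionic, or none. -/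
inductive Statistics : Type
  | bose
  | fermi
  | distinguishable

/-- The exchange symmetry of `ψ` (simultaneous permutation of positions and spins) at the
configuration `x`. -/
def Statistics.SymmetricAt {N : ℕ} (st : Statistics) (ψ : Config N → Spin N) (x : Config N) :
    Prop :=
  match st with
  | .bose => ∀ (π : Equiv.Perm (Fin N)) (s : Fin N → Fin 2), ψ (x ∘ π) (s ∘ π) = ψ x s
  | .fermi => ∀ (π : Equiv.Perm (Fin N)) (s : Fin N → Fin 2),
      ψ (x ∘ π) (s ∘ π) = ((Equiv.Perm.sign π : ℤ) : ℂ) * ψ x s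
  | .distinguishable => True

/-- Permuting the particles preserves Lebesgue measure. -/
theorem measurePreserving_perm {N : ℕ} (π : Equiv.Perm (Fin N)) :
    MeasurePreserving (fun x : Config N => x ∘ π) volume volume := by
  have h := volume_measurePreserving_piCongrLeft (fun _ : Fin N => Space) π.symm
  have e : ⇑(MeasurableEquiv.piCongrLeft (fun _ : Fin N => Space) π.symm)
      = fun x : Config N => x ∘ π := by
    funext x i
    have := MeasurableEquiv.piCongrLeft_apply_apply (e := π.symm)
      (β := fun _ : Fin N => Space) x (π i)
    simpa using this
  rwa [e] at h

theorem ae_forall_perm {N : ℕ} {p : Config N → Prop} (h : ∀ᵐ x, p x) :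
    ∀ᵐ x : Config N, ∀ π : Equiv.Perm (Fin N), p (x ∘ π) :=
  ae_all_iff.2 fun π => (measurePreserving_perm π).quasiMeasurePreserving.ae h

/-- The Hilbert space of `N` particles with the given statistics. -/
def hilbert (st : Statistics) (N : ℕ) : Submodule ℂ (L2 N) where
  carrier := {ψ | ∀ᵐ x, st.SymmetricAt (ψ : Config N → Spin N) x}
  zero_mem' := by
    have h0 := Lp.coeFn_zero (Spin N) 2 (volume : Measure (Config N))
    show ∀ᵐ x, _
    filter_upwards [h0, ae_forall_perm h0] with x hx hπ
    cases st
    · intro π s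
      rw [hx, hπ]
      rfl
    · intro π s
      rw [hx, hπ]
      simp
    · trivial
  add_mem' := by
    intro f g hf hg
    have h0 := Lp.coeFn_add f g
    show ∀ᵐ x, _
    filter_upwards [hf, hg, h0, ae_forall_perm h0] with x hf hg hx hπ
    cases st
    · intro π s
      rw [hx, hπ]
      simp only [Pi.add_apply, PiLp.add_apply]
      rw [hf π s, hg π s]
    · intro π s
      rw [hx, hπ]
      simp only [Pi.add_apply, PiLp.add_apply]
      rw [hf π s, hg π s, mul_add]
    · trivial
  smul_mem' := by
    intro c f hf
    have h0 := Lp.coeFn_smul c f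
    show ∀ᵐ x, _
    filter_upwards [hf, h0, ae_forall_perm h0] with x hf hx hπ
    cases st
    · intro π s
      rw [hx, hπ]
      simp only [Pi.smul_apply, PiLp.smul_apply]
      rw [hf π s]
    · intro π s
      rw [hx, hπ]
      simp only [Pi.smul_apply, PiLp.smul_apply, smul_eq_mul]
      rw [hf π s]
      ring
    · trivial

/-- Smooth compactly supported wave functions with the given statistics. -/
def core (st : Statistics) (N : ℕ) : Set (Config N → Spin N) :=
  {ψ | ContDiff ℝ ∞ ψ ∧ HasCompactSupport ψ ∧ ∀ x, st.SymmetricAt ψ x}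

/-- The Pauli matrices `σ_x, σ_y, σ_z`. -/
def pauli : Fin 3 → Matrix (Fin 2) (Fin 2) ℂ :=
  ![!![0, 1; 1, 0], !![0, -Complex.I; Complex.I, 0], !![1, 0; 0, -1]]

/-- The `a`-th component of `(-i∇_j + A(x_j)) ψ`. -/
def momentum {N : ℕ} (A : Space → Space) (j : Fin N) (a : Fin 3) (ψ : Config N → Spin N)
    (x : Config N) : Spin N :=
  (-Complex.I) • fderiv ℝ ψ x (Pi.single j (EuclideanSpace.single a 1))
    + ((A (x j) a : ℝ) : ℂ) • ψ x

/-- The Pauli matrix `σ_a` acting on the spin of the `j`-th particle. -/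
def spinAct {N : ℕ} (j : Fin N) (a : Fin 3) (v : Spin N) : Spin N :=
  WithLp.toLp 2 fun s => ∑ t : Fin 2, pauli a (s j) t * v (Function.update s j t)

/-- `σ_j · (-i∇_j + A(x_j)) ψ`. -/
def dirac {N : ℕ} (A : Space → Space) (j : Fin N) (ψ : Config N → Spin N) (x : Config N) :
    Spin N :=
  ∑ a : Fin 3, spinAct j a (momentum A j a ψ x)

/-- The Coulomb potential `-∑_i Z/|x_i| + ∑_{i<j} 1/|x_i - x_j|`. -/
def coulomb {N : ℕ} (Z : ℝ) (x : Config N) : ℝ :=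
  -(∑ i, Z / ‖x i‖) + ∑ i, ∑ j ∈ Finset.Ioi i, 1 / ‖x i - x j‖

/-- The sesquilinear form `⟨φ, H ψ⟩` of
`H = ∑_j [σ_j · (-i∇_j + A(x_j))]² - ∑_i Z/|x_i| + ∑_{i<j} 1/|x_i - x_j|`
(meant for `φ`, `ψ` smooth with compact support, where all integrals converge if `A` is locally
square integrable). -/
def form {N : ℕ} (A : Space → Space) (Z : ℝ) (φ ψ : Config N → Spin N) : ℂ :=
  (∑ j : Fin N, ∫ x, inner ℂ (dirac A j φ x) (dirac A j ψ x))
    + ∫ x, ((coulomb Z x : ℝ) : ℂ) * inner ℂ (φ x) (ψ x)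

/-- The form is bounded below, `⟨ψ, H ψ⟩ ≥ c ‖ψ‖²`; this is what finiteness of the ground state
energy means. -/
def BoundedBelow (st : Statistics) (A : Space → Space) (N : ℕ) (Z : ℝ) : Prop :=
  ∃ c : ℝ, ∀ ψ ∈ core st N, c * ∫ x, ‖ψ x‖ ^ 2 ≤ (form A Z ψ ψ).re

/-- The Hamiltonian `H_{N,Z,A}`, given by its graph: it is the operator associated with the closure
of the form. That is, `(ψ, η)` is in the graph when `ψ` is the `L²` limit of a sequence `u` in the
core which is Cauchy for the form (so that `ψ` is in the domain of the closed form), and the closed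
form satisfies `h(φ, ψ) = lim h(φ, u_n) = ⟨φ, η⟩` for all `φ` in the core. -/
def hamiltonian (st : Statistics) (A : Space → Space) (N : ℕ) (Z : ℝ) :
    Set (hilbert st N × hilbert st N) :=
  {p | ∃ u : ℕ → Config N → Spin N, (∀ n, u n ∈ core st N) ∧
      Tendsto (fun n => eLpNorm (fun x => u n x - (p.1 : L2 N) x) 2 volume) atTop (𝓝 0) ∧
      Tendsto (fun m : ℕ × ℕ => form A Z (u m.1 - u m.2) (u m.1 - u m.2)) atTop (𝓝 0) ∧
      ∀ φ ∈ core st N, Tendsto (fun n => form A Z φ (u n)) atTop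
        (𝓝 (∫ x, inner ℂ (φ x) ((p.2 : L2 N) x)))}

/-- The spectrum of an operator with graph `T`: `z` is in the resolvent set when `T - z` has an
everywhere defined bounded inverse `R`, i.e. `T ψ = η ↔ ψ = R (η - z ψ)`. -/
def spec {E : Type*} [NormedAddCommGroup E] [NormedSpace ℂ E] (T : Set (E × E)) : Set ℂ :=
  {z | ¬ ∃ R : E →L[ℂ] E, ∀ ψ η : E, (ψ, η) ∈ T ↔ ψ = R (η - z • ψ)}

/-- `z` is an eigenvalue of the operator with graph `T`. -/
def IsEigenvalue {E : Type*} [NormedAddCommGroup E] [NormedSpace ℂ E] (T : Set (E × E)) (z : ℂ) :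
    Prop :=
  ∃ ψ : E, ψ ≠ 0 ∧ (ψ, z • ψ) ∈ T

/-- The ground state energy `E(N, Z) = inf spec H_{N,Z,A}`. -/
def energy (st : Statistics) (A : Space → Space) (N : ℕ) (Z : ℝ) : ℝ :=
  sInf {e : ℝ | (e : ℂ) ∈ spec (hamiltonian st A N Z)}

/-- The particle numbers `N ≥ 1` for which the ground state energy is an eigenvalue. -/
def boundNumbers (st : Statistics) (A : Space → Space) (Z : ℝ) : Set ℕ :=
  {N | 1 ≤ N ∧ IsEigenvalue (hamiltonian st A N Z) ((energy st A N Z : ℝ) : ℂ)}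

/-- `N_c` is the critical particle number: the largest `N` such that the ground state energy is an
eigenvalue. -/
def IsCriticalNumber (st : Statistics) (A : Space → Space) (Z : ℝ) (Nc : ℕ) : Prop :=
  IsGreatest (boundNumbers st A Z) Nc

/-- `A ∈ L²_loc(ℝ³; ℝ³)`. -/
def LocallySquareIntegrable (A : Space → Space) : Prop :=
  ∀ K : Set Space, IsCompact K → MemLp A 2 (volume.restrict K)

end PauliAtom

end

/-!
Lieb's bound on the number of bound electrons, in the form that survives a magnetic field coupled
to spin. Let `ψ` be a ground state of `N` particles with energy `E`. Testing the eigenvalue equation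
with `∑_i |x_i| ψ` gives four contributions.

* With particle `i` frozen, the other `N - 1` particles have energy at least
  `E(N - 1, Z) ≥ E(N, Z)`, so this part outweighs the eigenvalue term (`weighted_form_le`).
* The kinetic energy of particle `i` satisfies
  `Re ⟨|x| ψ, (σ · p)² ψ⟩ ≥ - ⟨ψ, ψ / |x|⟩ / 4`, by completing the square (`le_re_inner_dirac`).
  Without spin, Hardy's inequality and the diamagnetic inequality would remove this error; for the
  Pauli operator it stays, and is bounded by comparing the charges `Z` and `k Z`:
  `(k - 1) Z ⟨∑_i 1 / |x_i|⟩ ≤ E(N, Z) - E(N, k Z)` (`integral_attraction_le`).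
* The nuclear attraction gives exactly `- N Z`.
* The repulsion gives `∑_{i < j} (|x_i| + |x_j|) / |x_i - x_j|`, which exceeds `N (N - 1) / 2` almost
  everywhere by the triangle inequality (`ae_lt_weightedRepulsion`).

Adding up, `N (N - 1) / 2 < Z N + (E(N, Z) - E(N, k Z)) / (4 (k - 1) Z)`, which is the claimed bound.
That the set of admissible `N` is bounded follows from this with `k = 2` and from `E(N, 2 Z) ≥ N c`
for a nonpositive lower bound `c` of the one-particle form, which holds because the repulsion is
positive (`nbody_lower_bound`).

Neither `|x|` nor `ψ` may be inserted directly in the form. The weight is replaced by the smooth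
bounded `liebWeight δ`, and `ψ` by a form-Cauchy sequence in the core, on which the weighted
inequality holds exactly (`integral_weightedRepulsion_le`). The limits are taken with Fatou's lemma,
first in the sequence and then in `δ`.

Only two facts on the spectrum are used: the form is at least `inf spec` on the core, and `inf spec`
is at least any nonpositive lower bound of the form. They are proved for arbitrary sesquilinear forms
with the resolvent `J J*`, where `J` maps the form domain to the Hilbert space.
-/

open MeasureTheory Filter Topology
open scoped ContDiff InnerProductSpace

noncomputable section

namespace PauliAtom

/-! ### Operators associated with sesquilinear forms -/

section FormGraph

variable {X H : Type*} [AddCommGroup X] [Module ℂ X] [NormedAddCommGroup H] [InnerProductSpace ℂ H]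

/-- The graph of the operator associated with a sesquilinear form `b` on `X`, where `X` is sent to
the Hilbert space `H` by `J`. Elements of the completion of `X` in the form norm appear as
form-Cauchy sequences, and `b` need not be closable. -/
def formGraph (b : X →ₗ⋆[ℂ] X →ₗ[ℂ] ℂ) (J : X →ₗ[ℂ] H) : Set (H × H) :=
  {p | ∃ u : ℕ → X, Tendsto (fun n => J (u n)) atTop (𝓝 p.1) ∧
      Tendsto (fun m : ℕ × ℕ => b (u m.1 - u m.2) (u m.1 - u m.2)) atTop (𝓝 0) ∧
      ∀ φ, Tendsto (fun n => b φ (u n)) atTop (𝓝 ⟪J φ, p.2⟫_ℂ)}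

theorem re_form_sub_inner (b : X →ₗ⋆[ℂ] X →ₗ[ℂ] ℂ) (J : X →ₗ[ℂ] H) (c : ℝ) (x : X) :
    (b x x - c * ⟪J x, J x⟫_ℂ).re = (b x x).re - c * ‖J x‖ ^ 2 := by
  rw [inner_self_eq_norm_sq_to_K, Complex.sub_re]
  change _ - ((c : ℂ) * ((‖J x‖ : ℝ) : ℂ) ^ 2).re = _
  rw [← Complex.ofReal_pow, ← Complex.ofReal_mul, Complex.ofReal_re]

/-- The positive semidefinite form `b - c ⟨J ·, J ·⟩` for a lower bound `c` of `b`. -/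
@[reducible] def shiftedCore (b : X →ₗ⋆[ℂ] X →ₗ[ℂ] ℂ) (J : X →ₗ[ℂ] H) (c : ℝ)
    (hherm : ∀ x y, (starRingEnd ℂ) (b y x) = b x y)
    (hlow : ∀ x, c * ‖J x‖ ^ 2 ≤ (b x x).re) : PreInnerProductSpace.Core ℂ X where
  inner x y := b x y - c * ⟪J x, J y⟫_ℂ
  conj_inner_symm x y := by simp [hherm]
  re_inner_nonneg x := by
    rw [RCLike.re_to_complex, re_form_sub_inner]
    linarith [hlow x]
  add_left x y z := by simp; ring
  smul_left x y r := by simp; ring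

end FormGraph

section SemiInner

theorem exists_norm_le_of_cauchy {X : Type*} [SeminormedAddCommGroup X] {u : ℕ → X}
    (hc : Tendsto (fun m : ℕ × ℕ => ‖u m.1 - u m.2‖) atTop (𝓝 0)) : ∃ K, ∀ n, ‖u n‖ ≤ K := by
  obtain ⟨⟨a, b⟩, hab⟩ := (Metric.tendsto_atTop.1 hc) 1 one_pos
  have hev : ∀ᶠ n in atTop, ‖u n‖ ≤ 1 + ‖u b‖ := by
    filter_upwards [eventually_ge_atTop a] with n hn
    have h1 := hab (n, b) ⟨hn, le_rfl⟩
    simp only [dist_zero_right, norm_norm] at h1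
    have := norm_le_norm_sub_add (u n) (u b)
    linarith
  have := (Filter.isBoundedUnder_of_eventually_le hev).bddAbove_range
  obtain ⟨K, hK⟩ := this
  exact ⟨K, fun n => hK ⟨n, rfl⟩⟩

variable {X H : Type*} [SeminormedAddCommGroup X] [InnerProductSpace ℂ X]
  [NormedAddCommGroup H] [InnerProductSpace ℂ H]

/-- If `⟨φ, u n⟩ → ⟨J φ, f⟩` for each fixed `φ` and `u` is Cauchy, the convergence is uniform
over bounded sets of `φ`. -/
theorem tendsto_inner_sub_of_cauchy (J : X →ₗ[ℂ] H) {u v : ℕ → X} {f : H} {K : ℝ}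
    (hc : Tendsto (fun m : ℕ × ℕ => ‖u m.1 - u m.2‖) atTop (𝓝 0))
    (hl : ∀ φ, Tendsto (fun n => ⟪φ, u n⟫_ℂ) atTop (𝓝 ⟪J φ, f⟫_ℂ)) (hv : ∀ n, ‖v n‖ ≤ K) :
    Tendsto (fun n => ⟪v n, u n⟫_ℂ - ⟪J (v n), f⟫_ℂ) atTop (𝓝 0) := by
  rw [Metric.tendsto_atTop]
  intro ε hε
  have hK : 0 ≤ K := (norm_nonneg _).trans (hv 0)
  obtain ⟨⟨a, b⟩, hab⟩ := (Metric.tendsto_atTop.1 hc) (ε / (2 * (K + 1))) (by positivity)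
  refine ⟨max a b, fun n hn => ?_⟩
  have hlim : Tendsto (fun m => ⟪v n, u n⟫_ℂ - ⟪v n, u m⟫_ℂ) atTop
      (𝓝 (⟪v n, u n⟫_ℂ - ⟪J (v n), f⟫_ℂ)) := tendsto_const_nhds.sub (hl _)
  have hle : ‖⟪v n, u n⟫_ℂ - ⟪J (v n), f⟫_ℂ‖ ≤ ε / 2 := by
    refine le_of_tendsto hlim.norm ?_
    filter_upwards [eventually_ge_atTop (max a b)] with m hm
    rw [← inner_sub_right]
    have h1 := hab (n, m) ⟨(le_max_left _ _).trans hn, (le_max_right _ _).trans hm⟩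
    simp only [dist_zero_right, norm_norm] at h1
    calc ‖⟪v n, u n - u m⟫_ℂ‖ ≤ ‖v n‖ * ‖u n - u m‖ := norm_inner_le_norm _ _
      _ ≤ (K + 1) * (ε / (2 * (K + 1))) := by
        gcongr
        linarith [hv n]
      _ = ε / 2 := by field_simp
  rw [dist_zero_right]
  linarith

/-- The Friedrichs resolvent `J J*`, with `J` extended to the completion of `X`. -/
theorem exists_resolvent [CompleteSpace H] (J : X →L[ℂ] H) :
    ∃ R : H →L[ℂ] H, ∀ ψ f, ψ = R f ↔ ∃ u : ℕ → X, Tendsto (fun n => J (u n)) atTop (𝓝 ψ) ∧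
      Tendsto (fun m : ℕ × ℕ => ‖u m.1 - u m.2‖) atTop (𝓝 0) ∧
      ∀ φ, Tendsto (fun n => ⟪φ, u n⟫_ℂ) atTop (𝓝 ⟪J φ, f⟫_ℂ) := by
  let ι : X →L[ℂ] UniformSpace.Completion X := UniformSpace.Completion.toComplL
  have hdense : DenseRange ι := UniformSpace.Completion.denseRange_coe
  have hiso : Isometry ι := UniformSpace.Completion.coe_isometry
  have hui : IsUniformInducing ι := hiso.isUniformInducing
  let J' : UniformSpace.Completion X →L[ℂ] H := J.extend ι
  have hJ' : ∀ x, J' (ι x) = J x := fun x => ContinuousLinearMap.extend_eq J hdense hui x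
  have hin : ∀ x y, ⟪ι x, ι y⟫_ℂ = ⟪x, y⟫_ℂ := fun x y => UniformSpace.Completion.inner_coe x y
  have hnorm : ∀ x, ‖ι x‖ = ‖x‖ := fun x => UniformSpace.Completion.norm_coe x
  have hpair : ∀ f φ, ⟪ι φ, ContinuousLinearMap.adjoint J' f⟫_ℂ = ⟪J φ, f⟫_ℂ := fun f φ => by
    rw [ContinuousLinearMap.adjoint_inner_right, hJ']
  refine ⟨J' ∘L ContinuousLinearMap.adjoint J', fun ψ f => ⟨?_, ?_⟩⟩
  · rintro rfl
    set w := ContinuousLinearMap.adjoint J' f with hw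
    obtain ⟨s, hs, hsw⟩ := mem_closure_iff_seq_limit.1 (hdense w)
    choose u hu using hs
    have huw : Tendsto (fun n => ι (u n)) atTop (𝓝 w) := by simpa only [hu] using hsw
    refine ⟨u, ?_, ?_, fun φ => ?_⟩
    · have := (J'.continuous.tendsto w).comp huw
      simp only [Function.comp_def, hJ'] at this
      exact this
    · have h2 : Tendsto (fun m : ℕ × ℕ => ι (u m.1) - ι (u m.2)) atTop (𝓝 (w - w)) := by
        rw [← prod_atTop_atTop_eq]
        exact (huw.comp tendsto_fst).sub (huw.comp tendsto_snd)
      have h3 := h2.norm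
      simpa only [sub_self, norm_zero, ← map_sub, hnorm] using h3
    · have h2 : Tendsto (fun n => ⟪ι φ, ι (u n)⟫_ℂ) atTop (𝓝 ⟪ι φ, w⟫_ℂ) :=
        tendsto_const_nhds.inner huw
      simpa only [hin, hw, hpair] using h2
  · rintro ⟨u, h1, h2, h3⟩
    have hcau : CauchySeq fun n => ι (u n) := by
      rw [cauchySeq_iff_tendsto_dist_atTop_0]
      simpa only [dist_eq_norm, ← map_sub, hnorm] using h2
    obtain ⟨w, hw⟩ := cauchySeq_tendsto_of_complete hcau
    have hww : w = ContinuousLinearMap.adjoint J' f := by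
      refine hdense.eq_of_inner_right ℂ ?_
      intro φ
      rw [hpair]
      refine tendsto_nhds_unique (f := fun n => ⟪ι φ, ι (u n)⟫_ℂ)
        (tendsto_const_nhds.inner hw) ?_
      simpa only [hin] using h3 φ
    have h4 := (J'.continuous.tendsto w).comp hw
    simp only [Function.comp_def, hJ'] at h4
    rw [tendsto_nhds_unique h1 h4, hww]
    rfl

end SemiInner

section Spectrum

variable {X H : Type*} [AddCommGroup X] [Module ℂ X] [NormedAddCommGroup H] [InnerProductSpace ℂ H]

theorem tendsto_map_sub_prod {J : X →ₗ[ℂ] H} {u : ℕ → X} {ψ : H}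
    (h : Tendsto (fun n => J (u n)) atTop (𝓝 ψ)) :
    Tendsto (fun m : ℕ × ℕ => J (u m.1 - u m.2)) atTop (𝓝 0) := by
  simp only [map_sub]
  rw [← sub_self ψ, ← prod_atTop_atTop_eq]
  exact (h.comp tendsto_fst).sub (h.comp tendsto_snd)

/-- Given `J (u n) → ψ`, being Cauchy for `b` and for the seminorm of `b - c ⟨J ·, J ·⟩` are the
same. -/
theorem tendsto_shifted_iff {b : X →ₗ⋆[ℂ] X →ₗ[ℂ] ℂ} {J : X →ₗ[ℂ] H} (c : ℝ) {u : ℕ → X} {ψ : H}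
    (h : Tendsto (fun n => J (u n)) atTop (𝓝 ψ)) :
    Tendsto (fun m : ℕ × ℕ => b (u m.1 - u m.2) (u m.1 - u m.2)
      - c * ⟪J (u m.1 - u m.2), J (u m.1 - u m.2)⟫_ℂ) atTop (𝓝 0) ↔
    Tendsto (fun m : ℕ × ℕ => b (u m.1 - u m.2) (u m.1 - u m.2)) atTop (𝓝 0) := by
  have h0 := tendsto_map_sub_prod h
  have h1 : Tendsto (fun m : ℕ × ℕ => (c : ℂ) * ⟪J (u m.1 - u m.2), J (u m.1 - u m.2)⟫_ℂ) atTop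
      (𝓝 0) := by
    simpa using (h0.inner h0).const_mul (c : ℂ)
  constructor
  · intro h2
    simpa using h2.add h1
  · intro h2
    simpa using h2.sub h1

/-- The data of a graph element, in terms of the inner product `b - c ⟨J ·, J ·⟩`. -/
theorem mem_formGraph_iff_shifted {b : X →ₗ⋆[ℂ] X →ₗ[ℂ] ℂ} {J : X →ₗ[ℂ] H} (c : ℝ) {ψ η : H} :
    (ψ, η) ∈ formGraph b J ↔ ∃ u : ℕ → X, Tendsto (fun n => J (u n)) atTop (𝓝 ψ) ∧
      Tendsto (fun m : ℕ × ℕ => b (u m.1 - u m.2) (u m.1 - u m.2)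
        - c * ⟪J (u m.1 - u m.2), J (u m.1 - u m.2)⟫_ℂ) atTop (𝓝 0) ∧
      ∀ φ, Tendsto (fun n => b φ (u n) - c * ⟪J φ, J (u n)⟫_ℂ) atTop
        (𝓝 ⟪J φ, η - (c : ℂ) • ψ⟫_ℂ) := by
  refine exists_congr fun u => and_congr_right fun h => ?_
  rw [tendsto_shifted_iff c h]
  refine and_congr_right fun _ => forall_congr' fun φ => ?_
  have h1 : Tendsto (fun n => (c : ℂ) * ⟪J φ, J (u n)⟫_ℂ) atTop (𝓝 (c * ⟪J φ, ψ⟫_ℂ)) :=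
    (tendsto_const_nhds.inner h).const_mul _
  simp only [inner_sub_right, inner_smul_right]
  constructor
  · intro h2
    exact h2.sub h1
  · intro h2
    simpa using h2.add h1

variable {b : X →ₗ⋆[ℂ] X →ₗ[ℂ] ℂ} {J : X →ₗ[ℂ] H} {c : ℝ}

/-- A sequence that realises `(ψ, η)` in the graph represents `η` uniformly on form-bounded
sequences. -/
theorem tendsto_form_sub_inner (hherm : ∀ x y, (starRingEnd ℂ) (b y x) = b x y)
    (hlow : ∀ x, c * ‖J x‖ ^ 2 ≤ (b x x).re) {u v : ℕ → X} {ψ η : H} {K : ℝ}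
    (hψ : Tendsto (fun n => J (u n)) atTop (𝓝 ψ))
    (hc : Tendsto (fun m : ℕ × ℕ => b (u m.1 - u m.2) (u m.1 - u m.2)) atTop (𝓝 0))
    (hη : ∀ φ, Tendsto (fun n => b φ (u n)) atTop (𝓝 ⟪J φ, η⟫_ℂ))
    (hv : ∀ n, (b (v n) (v n)).re ≤ K) (hJv : ∀ n, ‖J (v n)‖ ^ 2 ≤ K) :
    Tendsto (fun n => b (v n) (u n) - ⟪J (v n), η⟫_ℂ) atTop (𝓝 0) := by
  let core := shiftedCore b J c hherm hlow
  let : SeminormedAddCommGroup X := InnerProductSpace.Core.toSeminormedAddCommGroup (𝕜 := ℂ)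
  let : InnerProductSpace ℂ X := InnerProductSpace.ofCore core
  have hin : ∀ x y : X, ⟪x, y⟫_ℂ = b x y - c * ⟪J x, J y⟫_ℂ := fun _ _ => rfl
  have hnorm : ∀ x : X, ‖x‖ ^ 2 = (b x x).re - c * ‖J x‖ ^ 2 := fun x => by
    rw [← inner_self_eq_norm_sq (𝕜 := ℂ) x, ← re_form_sub_inner]
    rfl
  have h0 := tendsto_map_sub_prod hψ
  have hc' : Tendsto (fun m : ℕ × ℕ => ‖u m.1 - u m.2‖) atTop (𝓝 0) := by
    have h1 : Tendsto (fun m : ℕ × ℕ => ‖u m.1 - u m.2‖ ^ 2) atTop (𝓝 0) := by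
      simp only [hnorm]
      have h2 := (Complex.continuous_re.tendsto _).comp hc
      simpa using h2.sub ((h0.norm.pow 2).const_mul c)
    simpa [Real.sqrt_sq (norm_nonneg _)] using h1.sqrt
  have hl : ∀ φ, Tendsto (fun n => ⟪φ, u n⟫_ℂ) atTop (𝓝 ⟪J φ, η - (c : ℂ) • ψ⟫_ℂ) := fun φ => by
    simp only [hin, inner_sub_right, inner_smul_right]
    exact (hη φ).sub ((tendsto_const_nhds.inner hψ).const_mul _)
  have hK : 0 ≤ K := (sq_nonneg _).trans (hJv 0)
  have hvn : ∀ n, ‖v n‖ ≤ Real.sqrt (K + |c| * K) := fun n => by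
    apply Real.le_sqrt_of_sq_le
    rw [hnorm]
    have h2 : -(c * ‖J (v n)‖ ^ 2) ≤ |c| * K := by
      calc -(c * ‖J (v n)‖ ^ 2) = -c * ‖J (v n)‖ ^ 2 := by ring
        _ ≤ |c| * ‖J (v n)‖ ^ 2 := by gcongr; exact neg_le_abs c
        _ ≤ |c| * K := by gcongr; exact hJv n
    linarith [hv n]
  have h3 := tendsto_inner_sub_of_cauchy J hc' hl hvn
  have h4 : Tendsto (fun n => (c : ℂ) * ⟪J (v n), J (u n) - ψ⟫_ℂ) atTop (𝓝 0) := by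
    have h5 : Tendsto (fun n => |c| * (Real.sqrt K * ‖J (u n) - ψ‖)) atTop (𝓝 0) := by
      have : Tendsto (fun n => J (u n) - ψ) atTop (𝓝 0) := by
        simpa using hψ.sub_const ψ
      simpa using (this.norm.const_mul (Real.sqrt K)).const_mul |c|
    refine squeeze_zero_norm (fun n => ?_) h5
    rw [norm_mul, Complex.norm_real, Real.norm_eq_abs]
    gcongr
    refine (norm_inner_le_norm _ _).trans ?_
    gcongr
    exact Real.le_sqrt_of_sq_le (hJv n)
  have h6 := h3.add h4
  simp only [add_zero] at h6
  refine h6.congr fun n => ?_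
  rw [hin]
  simp only [inner_sub_right, inner_smul_right]
  ring

/-- A form-Cauchy sequence that converges in `H` is bounded in form. -/
theorem exists_form_le_of_tendsto (hherm : ∀ x y, (starRingEnd ℂ) (b y x) = b x y)
    (hlow : ∀ x, c * ‖J x‖ ^ 2 ≤ (b x x).re) {u : ℕ → X} {ψ : H}
    (hψ : Tendsto (fun n => J (u n)) atTop (𝓝 ψ))
    (hc : Tendsto (fun m : ℕ × ℕ => b (u m.1 - u m.2) (u m.1 - u m.2)) atTop (𝓝 0)) :
    ∃ K, ∀ n, (b (u n) (u n)).re ≤ K ∧ ‖J (u n)‖ ^ 2 ≤ K := by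
  let core := shiftedCore b J c hherm hlow
  let : SeminormedAddCommGroup X := InnerProductSpace.Core.toSeminormedAddCommGroup (𝕜 := ℂ)
  let : InnerProductSpace ℂ X := InnerProductSpace.ofCore core
  have hin : ∀ x y : X, ⟪x, y⟫_ℂ = b x y - c * ⟪J x, J y⟫_ℂ := fun _ _ => rfl
  have hnorm : ∀ x : X, ‖x‖ ^ 2 = (b x x).re - c * ‖J x‖ ^ 2 := fun x => by
    rw [← inner_self_eq_norm_sq (𝕜 := ℂ) x, ← re_form_sub_inner]
    rfl
  have h0 := tendsto_map_sub_prod hψ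
  have hc' : Tendsto (fun m : ℕ × ℕ => ‖u m.1 - u m.2‖) atTop (𝓝 0) := by
    have h1 : Tendsto (fun m : ℕ × ℕ => ‖u m.1 - u m.2‖ ^ 2) atTop (𝓝 0) := by
      simp only [hnorm]
      have h2 := (Complex.continuous_re.tendsto _).comp hc
      simpa using h2.sub ((h0.norm.pow 2).const_mul c)
    simpa [Real.sqrt_sq (norm_nonneg _)] using h1.sqrt
  obtain ⟨K, hK⟩ := exists_norm_le_of_cauchy hc'
  obtain ⟨K', hK'⟩ := hψ.norm.bddAbove_range
  have hK'' : ∀ n, ‖J (u n)‖ ^ 2 ≤ K' ^ 2 := fun n => by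
    have : ‖J (u n)‖ ≤ K' := hK' ⟨n, rfl⟩
    gcongr
  have hK2 : ∀ n, ‖u n‖ ^ 2 ≤ K ^ 2 := fun n => by
    have := hK n
    gcongr
  refine ⟨K ^ 2 + |c| * K' ^ 2 + K' ^ 2, fun n => ⟨?_, ?_⟩⟩
  · have h1 := hnorm (u n)
    have h2 : c * ‖J (u n)‖ ^ 2 ≤ |c| * K' ^ 2 := by
      calc c * ‖J (u n)‖ ^ 2 ≤ |c| * ‖J (u n)‖ ^ 2 := by gcongr; exact le_abs_self c
        _ ≤ _ := by gcongr ?_ * ?_; exact hK'' n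
    linarith [hK2 n, sq_nonneg K']
  · have : 0 ≤ |c| * K' ^ 2 := by positivity
    linarith [hK'' n, sq_nonneg K]

/-- The form converges to `⟨ψ, η⟩` along any sequence that realises `(ψ, η)` in the graph. -/
theorem tendsto_form_self (hherm : ∀ x y, (starRingEnd ℂ) (b y x) = b x y)
    (hlow : ∀ x, c * ‖J x‖ ^ 2 ≤ (b x x).re) {u : ℕ → X} {ψ η : H}
    (hψ : Tendsto (fun n => J (u n)) atTop (𝓝 ψ))
    (hc : Tendsto (fun m : ℕ × ℕ => b (u m.1 - u m.2) (u m.1 - u m.2)) atTop (𝓝 0))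
    (hη : ∀ φ, Tendsto (fun n => b φ (u n)) atTop (𝓝 ⟪J φ, η⟫_ℂ)) :
    Tendsto (fun n => b (u n) (u n)) atTop (𝓝 ⟪ψ, η⟫_ℂ) := by
  obtain ⟨K, hK⟩ := exists_form_le_of_tendsto hherm hlow hψ hc
  have h1 := tendsto_form_sub_inner hherm hlow hψ hc hη (fun n => (hK n).1) fun n => (hK n).2
  have h2 : Tendsto (fun n => ⟪J (u n), η⟫_ℂ) atTop (𝓝 ⟪ψ, η⟫_ℂ) := hψ.inner tendsto_const_nhds
  simpa using h1.add h2

/-- Numbers below a lower bound of the form lie in the resolvent set. -/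
theorem ofReal_notMem_spec_formGraph [CompleteSpace H]
    (hherm : ∀ x y, (starRingEnd ℂ) (b y x) = b x y)
    (hlow : ∀ x, c * ‖J x‖ ^ 2 ≤ (b x x).re) {z : ℝ} (hz : z < c) :
    (z : ℂ) ∉ spec (formGraph b J) := by
  have hlow' : ∀ x, z * ‖J x‖ ^ 2 ≤ (b x x).re := fun x =>
    le_trans (by gcongr) (hlow x)
  let core := shiftedCore b J z hherm hlow'
  let : SeminormedAddCommGroup X := InnerProductSpace.Core.toSeminormedAddCommGroup (𝕜 := ℂ)
  let : InnerProductSpace ℂ X := InnerProductSpace.ofCore core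
  have hin : ∀ x y : X, ⟪x, y⟫_ℂ = b x y - z * ⟪J x, J y⟫_ℂ := fun _ _ => rfl
  have hnorm : ∀ x : X, ‖x‖ ^ 2 = (b x x).re - z * ‖J x‖ ^ 2 := fun x => by
    rw [← inner_self_eq_norm_sq (𝕜 := ℂ) x, ← re_form_sub_inner]
    rfl
  have hJb : ∀ x : X, ‖J x‖ ≤ Real.sqrt ((c - z)⁻¹) * ‖x‖ := fun x => by
    have h1 : (c - z) * ‖J x‖ ^ 2 ≤ ‖x‖ ^ 2 := by
      rw [hnorm]
      linarith [hlow x]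
    rw [← Real.sqrt_sq (norm_nonneg x), ← Real.sqrt_mul (by simpa using hz.le)]
    apply Real.le_sqrt_of_sq_le
    rw [inv_mul_eq_div, le_div_iff₀ (by linarith)]
    linarith
  obtain ⟨R, hR⟩ := exists_resolvent (LinearMap.mkContinuous J _ hJb)
  rw [spec, Set.mem_ofPred_eq, not_not]
  refine ⟨R, fun ψ η => ?_⟩
  rw [mem_formGraph_iff_shifted z, hR]
  refine exists_congr fun u => and_congr_right fun h => ?_
  have hsq : ∀ x : X, b x x - z * ⟪J x, J x⟫_ℂ = ((‖x‖ ^ 2 : ℝ) : ℂ) := fun x => by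
    rw [← hin, inner_self_eq_norm_sq_to_K]
    simp
  refine and_congr ?_ Iff.rfl
  simp only [hsq]
  constructor
  · intro h1
    have h2 := (Complex.continuous_re.tendsto _).comp h1
    simp only [Function.comp_def, Complex.ofReal_re, Complex.zero_re] at h2
    simpa [Real.sqrt_sq (norm_nonneg _)] using h2.sqrt
  · intro h1
    have h2 := (Complex.continuous_ofReal.tendsto _).comp (h1.pow 2)
    simpa [Function.comp_def] using h2

/-- The greatest lower bound of the form belongs to the spectrum. -/
theorem sInf_mem_spec_formGraph (hherm : ∀ x y, (starRingEnd ℂ) (b y x) = b x y)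
    (hlow : ∀ x, c * ‖J x‖ ^ 2 ≤ (b x x).re)
    (hc : IsGreatest {c : ℝ | ∀ x, c * ‖J x‖ ^ 2 ≤ (b x x).re} c) :
    (c : ℂ) ∈ spec (formGraph b J) := by
  rintro ⟨R, hR⟩
  -- A bounded resolvent `R` at the infimum `c` would force `1 ≤ (b x x - c) ‖R‖` whenever
  -- `‖J x‖ = 1`, so a minimizer up to an error smaller than `1 / ‖R‖` gives a contradiction.
  set δ : ℝ := (‖R‖ + 1)⁻¹ with hδ
  have hδ0 : 0 < δ := by positivity
  obtain ⟨y, hy⟩ : ∃ y, (b y y).re < (c + δ) * ‖J y‖ ^ 2 := by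
    by_contra! h
    have := hc.2 h
    linarith
  have hy0 : ‖J y‖ ≠ 0 := fun h0 => by
    have := hlow y
    rw [h0] at this hy
    simp at this hy
    linarith
  set x : X := ((‖J y‖⁻¹ : ℝ) : ℂ) • y with hx
  have hJx : ‖J x‖ = 1 := by
    rw [hx, map_smul, norm_smul, Complex.norm_real, norm_inv, norm_norm, inv_mul_cancel₀ hy0]
  have hbx : (b x x).re < c + δ := by
    have : b x x = ((‖J y‖⁻¹ ^ 2 : ℝ) : ℂ) * b y y := by
      simp only [hx, map_smulₛₗ, LinearMap.smul_apply, smul_eq_mul, Complex.conj_ofReal,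
        RingHom.id_apply]
      push_cast
      ring
    rw [this, Complex.re_ofReal_mul, inv_pow, inv_mul_eq_div, div_lt_iff₀ (by positivity)]
    exact hy
  set ψ := R (J x) with hψ
  have hmem : (ψ, J x + (c : ℂ) • ψ) ∈ formGraph b J := by
    rw [hR, add_sub_cancel_right]
  obtain ⟨u, h1, h2, h3⟩ := hmem
  have h4 := tendsto_form_self hherm hlow h1 h2 h3
  let core := shiftedCore b J c hherm hlow
  let : SeminormedAddCommGroup X := InnerProductSpace.Core.toSeminormedAddCommGroup (𝕜 := ℂ)
  let : InnerProductSpace ℂ X := InnerProductSpace.ofCore core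
  have hin : ∀ x y : X, ⟪x, y⟫_ℂ = b x y - c * ⟪J x, J y⟫_ℂ := fun _ _ => rfl
  have hnorm : ∀ x : X, ‖x‖ ^ 2 = (b x x).re - c * ‖J x‖ ^ 2 := fun x => by
    rw [← inner_self_eq_norm_sq (𝕜 := ℂ) x, ← re_form_sub_inner]
    rfl
  have h5 : Tendsto (fun n => ‖u n‖ ^ 2) atTop (𝓝 (⟪ψ, J x⟫_ℂ).re) := by
    simp only [hnorm]
    have h6 := ((Complex.continuous_re.tendsto _).comp h4).sub ((h1.norm.pow 2).const_mul c)
    have : (⟪ψ, J x + (c : ℂ) • ψ⟫_ℂ).re - c * ‖ψ‖ ^ 2 = (⟪ψ, J x⟫_ℂ).re := by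
      rw [inner_add_right, inner_smul_right, inner_self_eq_norm_sq_to_K, Complex.add_re]
      simp only [Complex.coe_algebraMap]
      rw [← Complex.ofReal_pow, ← Complex.ofReal_mul, Complex.ofReal_re]
      ring
    rwa [this] at h6
  have h6 : Tendsto (fun n => ⟪x, u n⟫_ℂ) atTop (𝓝 1) := by
    simp only [hin]
    have h7 := (h3 x).sub ((tendsto_const_nhds (x := J x)).inner h1 |>.const_mul (c : ℂ))
    have : ⟪J x, J x + (c : ℂ) • ψ⟫_ℂ - c * ⟪J x, ψ⟫_ℂ = 1 := by
      rw [inner_add_right, inner_smul_right, inner_self_eq_norm_sq_to_K, hJx]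
      simp
    rwa [this] at h7
  have h7 : (1 : ℝ) ≤ ‖x‖ ^ 2 * (⟪ψ, J x⟫_ℂ).re := by
    have h8 := h6.norm.pow 2
    rw [norm_one, one_pow] at h8
    refine le_of_tendsto_of_tendsto' h8 (h5.const_mul (‖x‖ ^ 2)) fun n => ?_
    rw [← mul_pow]
    gcongr
    exact norm_inner_le_norm _ _
  have h8 : ‖x‖ ^ 2 ≤ δ := by
    rw [hnorm, hJx]
    linarith
  have h9 : (⟪ψ, J x⟫_ℂ).re ≤ ‖R‖ := by
    refine (Complex.re_le_norm _).trans ((norm_inner_le_norm _ _).trans ?_)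
    rw [hJx, mul_one, hψ]
    simpa [hJx] using R.le_opNorm (J x)
  have h10 : ‖x‖ ^ 2 * (⟪ψ, J x⟫_ℂ).re ≤ δ * ‖R‖ := by
    calc ‖x‖ ^ 2 * (⟪ψ, J x⟫_ℂ).re ≤ ‖x‖ ^ 2 * ‖R‖ := by gcongr
      _ ≤ δ * ‖R‖ := by gcongr
  have h11 : δ * ‖R‖ < 1 := by
    rw [hδ, inv_mul_eq_div, div_lt_one (by positivity)]
    linarith
  linarith

theorem le_of_mem_spec_formGraph [CompleteSpace H]
    (hherm : ∀ x y, (starRingEnd ℂ) (b y x) = b x y)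
    (hlow : ∀ x, c * ‖J x‖ ^ 2 ≤ (b x x).re) {z : ℝ} (hz : (z : ℂ) ∈ spec (formGraph b J)) :
    c ≤ z :=
  not_lt.1 fun h => ofReal_notMem_spec_formGraph hherm hlow h hz

/-- The bottom of the spectrum is a lower bound of the form. -/
theorem sInf_spec_formGraph_mul_le [CompleteSpace H]
    (hherm : ∀ x y, (starRingEnd ℂ) (b y x) = b x y)
    (hlow : ∀ x, c * ‖J x‖ ^ 2 ≤ (b x x).re) (x : X) :
    sInf {e : ℝ | (e : ℂ) ∈ spec (formGraph b J)} * ‖J x‖ ^ 2 ≤ (b x x).re := by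
  -- Only `J x ≠ 0` guarantees a greatest lower bound, hence a nonempty spectrum.
  by_cases hx : ‖J x‖ = 0
  · simpa [hx] using hlow x
  set S : Set ℝ := {c : ℝ | ∀ x, c * ‖J x‖ ^ 2 ≤ (b x x).re} with hS
  have hbdd : BddAbove S := by
    refine ⟨(b x x).re / ‖J x‖ ^ 2, fun d hd => ?_⟩
    rw [le_div_iff₀ (by positivity)]
    exact hd x
  have hg : IsGreatest S (sSup S) := by
    refine ⟨fun y => ?_, fun d hd => le_csSup hbdd hd⟩
    by_cases hy : ‖J y‖ = 0
    · simpa [hy] using hlow y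
    · rw [← le_div_iff₀ (by positivity)]
      refine csSup_le ⟨c, hlow⟩ fun d hd => ?_
      rw [le_div_iff₀ (by positivity)]
      exact hd y
  have hmem := sInf_mem_spec_formGraph hherm hg.1 hg
  refine le_trans ?_ (hg.1 x)
  gcongr
  exact csInf_le ⟨c, fun z hz => le_of_mem_spec_formGraph hherm hlow hz⟩ hmem

end Spectrum

/-! ### Local integrability of the Coulomb potential -/

section LocalIntegrability

variable {N : ℕ}

theorem locallyIntegrable_comp_eval {E : Type*} [NormedAddCommGroup E] {g : Space → E}
    (hg : LocallyIntegrable g) (i : Fin N) : LocallyIntegrable fun x : Config N => g (x i) := by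
  rw [locallyIntegrable_iff]
  intro K hK
  obtain ⟨R, hR⟩ := hK.isBounded.subset_closedBall 0
  have hsub : K ⊆ Set.pi Set.univ fun _ : Fin N => Metric.closedBall (0 : Space) R := by
    intro x hx j _
    have := hR hx
    rw [mem_closedBall_zero_iff] at this ⊢
    exact (norm_le_pi_norm x j).trans this
  refine IntegrableOn.mono_set ?_ hsub
  have hfin : IsFiniteMeasure (volume.restrict (Metric.closedBall (0 : Space) R)) :=
    ⟨by simpa using (isCompact_closedBall (0 : Space) R).measure_lt_top (μ := volume)⟩
  rw [IntegrableOn, volume_pi, Measure.restrict_pi_pi]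
  exact integrable_comp_eval (hg.integrableOn_isCompact (isCompact_closedBall 0 R))

theorem locallyIntegrable_inv_norm : LocallyIntegrable fun x : Space => 1 / ‖x‖ := by
  refine locallyIntegrable_of_norm_le_rpow (C := 1) (α := 1) ?_ ?_ ?_ ?_
  · simp
  · simp
  · refine Eventually.of_forall fun x => ?_
    rw [Real.rpow_neg_one]
    simp
  · exact (measurable_const.div measurable_norm).aestronglyMeasurable

theorem locallyIntegrable_inv_norm_eval (i : Fin N) :
    LocallyIntegrable fun x : Config N => 1 / ‖x i‖ :=
  locallyIntegrable_comp_eval locallyIntegrable_inv_norm i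

/-- The change of variables `x i ↦ x j - x i` turns the interaction into a one-body potential. -/
theorem locallyIntegrable_inv_norm_sub (i j : Fin N) :
    LocallyIntegrable fun x : Config N => 1 / ‖x i - x j‖ := by
  rcases eq_or_ne i j with rfl | hij
  · simpa using (locallyIntegrable_const (0 : ℝ))
  let e : Config N ≃ₗ[ℝ] Config N := LinearEquiv.ofInvolutive
    { toFun := fun x => Function.update x i (x j - x i)
      map_add' := fun x y => by
        ext k : 1
        rcases eq_or_ne k i with rfl | hk
        · simp; abel
        · simp [hk]
      map_smul' := fun c x => by
        ext k : 1
        rcases eq_or_ne k i with rfl | hk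
        · simp [smul_sub]
        · simp [hk] } (fun x => by
        ext k : 1
        rcases eq_or_ne k i with rfl | hk
        · simp [hij.symm]
        · simp [hk])
  have he : ∀ x, e x i = x j - x i := fun x => by
    change Function.update x i (x j - x i) i = _
    simp
  have hec : Continuous e := LinearMap.continuous_of_finiteDimensional (e : Config N →ₗ[ℝ] Config N)
  have hesymm : Continuous e.symm :=
    LinearMap.continuous_of_finiteDimensional (e.symm : Config N →ₗ[ℝ] Config N)
  let h : Config N ≃ₜ Config N := ⟨e.toEquiv, hec, hesymm⟩
  have hmap := Measure.map_linearMap_addHaar_eq_smul_addHaar (volume : Measure (Config N))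
    (f := (e : Config N →ₗ[ℝ] Config N)) e.isUnit_det'.ne_zero
  rw [locallyIntegrable_iff]
  intro K hK
  have hloc : IntegrableOn (fun x : Config N => 1 / ‖x i‖) (h '' K) volume :=
    (locallyIntegrable_inv_norm_eval i).integrableOn_isCompact (hK.image h.continuous)
  have h2 : IntegrableOn (fun x : Config N => 1 / ‖x i‖) (h '' K) (Measure.map h volume) := by
    have : Measure.map h volume = _ := hmap
    rw [this, IntegrableOn, Measure.restrict_smul]
    exact hloc.smul_measure ENNReal.ofReal_ne_top
  have h3 := (h.measurableEmbedding.integrableOn_map_iff).1 h2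
  rw [Set.preimage_image_eq _ h.injective] at h3
  refine h3.congr_fun (fun x _ => ?_) hK.measurableSet
  change 1 / ‖e x i‖ = _
  rw [he, norm_sub_rev]

/-- The Coulomb potential of some of the particles, selected by `τ`. -/
theorem locallyIntegrable_coulomb_comp {M : ℕ} (τ : Fin M → Fin N) (Z : ℝ) :
    LocallyIntegrable fun x : Config N => coulomb Z (x ∘ τ) := by
  unfold coulomb
  refine LocallyIntegrable.add (LocallyIntegrable.neg ?_) ?_
  · refine locallyIntegrable_finsetSum _ fun i _ => ?_
    have := (locallyIntegrable_inv_norm_eval (τ i)).smul Z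
    refine this.congr (Eventually.of_forall fun x => ?_)
    simp [div_eq_mul_inv]
  · exact locallyIntegrable_finsetSum _ fun i _ => locallyIntegrable_finsetSum _ fun j _ =>
      locallyIntegrable_inv_norm_sub (τ i) (τ j)

theorem locallyIntegrable_coulomb (Z : ℝ) : LocallyIntegrable fun x : Config N => coulomb Z x :=
  locallyIntegrable_coulomb_comp id Z

theorem integrable_mul_of_hasCompactSupport {V : Config N → ℝ} (hV : LocallyIntegrable V)
    {g : Config N → ℝ} (hg : Continuous g) (hs : HasCompactSupport g) :
    Integrable fun x => V x * g x := by
  simpa using hV.integrable_smul_right_of_hasCompactSupport hg hs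

end LocalIntegrability

/-! ### Pauli matrices -/

section Spin

variable {N : ℕ}

/-- `spinAct` as a continuous linear map. -/
def spinActL (j : Fin N) (a : Fin 3) : Spin N →L[ℂ] Spin N :=
  LinearMap.toContinuousLinearMap
    { toFun := spinAct j a
      map_add' := fun v w => by
        ext s
        simp [spinAct, mul_add, Finset.sum_add_distrib]
      map_smul' := fun c v => by
        ext s
        simp only [spinAct, PiLp.smul_apply, smul_eq_mul, RingHom.id_apply, Finset.mul_sum]
        exact Finset.sum_congr rfl fun t _ => by ring }

@[simp]
theorem spinActL_apply (j : Fin N) (a : Fin 3) (v : Spin N) : spinActL j a v = spinAct j a v := rfl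

/-- `σ_j · w` for a complex vector `w`. -/
def spinVec (j : Fin N) (w : Fin 3 → ℂ) : Spin N →L[ℂ] Spin N := ∑ a, w a • spinActL j a

theorem spinVec_apply (j : Fin N) (w : Fin 3 → ℂ) (v : Spin N) :
    spinVec j w v = ∑ a, w a • spinAct j a v := by
  simp [spinVec]

/-- Summing over the spin of particle `j` twice counts each configuration twice; this isolates the
two components on which `σ_j` acts. -/
theorem sum_spin_eq_sum_update (j : Fin N) (g : (Fin N → Fin 2) → ℝ) :
    2 * ∑ s, g s = ∑ s, ∑ t : Fin 2, g (Function.update s j t) := by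
  have hflip : ∀ t : Fin 2, t = 0 ∨ t = 1 := by decide
  let e : (Fin N → Fin 2) ≃ (Fin N → Fin 2) :=
    Function.Involutive.toPerm (fun s => Function.update s j (1 - s j)) fun s => by
      ext k : 1
      rcases eq_or_ne k j with rfl | hk
      · simp
      · simp [hk]
  have he : ∑ s, g (e s) = ∑ s, g s := e.sum_comp g
  rw [two_mul]
  nth_rewrite 1 [← he]
  rw [← Finset.sum_add_distrib]
  refine Finset.sum_congr rfl fun s _ => ?_
  have h1 : e s = Function.update s j (1 - s j) := rfl
  have h2 : g s = g (Function.update s j (s j)) := by rw [Function.update_eq_self]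
  rw [Fin.sum_univ_two, h1, h2]
  rcases hflip (s j) with h | h <;> simp [h, add_comm]

/-- `(σ · w)² = |w|²` for a real vector `w`, in the form of an isometry property. -/
theorem norm_spinVec_ofReal (j : Fin N) (w : Space) (v : Spin N) :
    ‖spinVec j (fun a => ((w a : ℝ) : ℂ)) v‖ = ‖w‖ * ‖v‖ := by
  have key : ‖spinVec j (fun a => ((w a : ℝ) : ℂ)) v‖ ^ 2 = ‖w‖ ^ 2 * ‖v‖ ^ 2 := by
    rw [EuclideanSpace.norm_sq_eq, EuclideanSpace.norm_sq_eq, EuclideanSpace.norm_sq_eq]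
    refine mul_left_cancel₀ (two_ne_zero (α := ℝ)) ?_
    rw [sum_spin_eq_sum_update j, mul_left_comm, sum_spin_eq_sum_update j, Finset.mul_sum]
    refine Finset.sum_congr rfl fun s _ => ?_
    set p := v (Function.update s j 0)
    set q := v (Function.update s j 1)
    have h0 : spinVec j (fun a => ((w a : ℝ) : ℂ)) v (Function.update s j 0)
        = (w 0 - w 1 * Complex.I) * q + w 2 * p := by
      rw [spinVec_apply]
      simp [spinAct, Fin.sum_univ_three, Fin.sum_univ_two, pauli, p, q]
      ring
    have h1 : spinVec j (fun a => ((w a : ℝ) : ℂ)) v (Function.update s j 1)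
        = (w 0 + w 1 * Complex.I) * p - w 2 * q := by
      rw [spinVec_apply]
      simp [spinAct, Fin.sum_univ_three, Fin.sum_univ_two, pauli, p, q]
      ring
    rw [Fin.sum_univ_two, Fin.sum_univ_two, Fin.sum_univ_three, h0, h1]
    simp only [← Complex.normSq_eq_norm_sq, Complex.normSq_apply, Real.norm_eq_abs, sq_abs]
    simp
    ring
  rw [← mul_pow] at key
  exact (pow_left_inj₀ (norm_nonneg _) (by positivity) two_ne_zero).1 key

end Spin

/-! ### The operator `σ · (-i∇ + A)` -/

section Dirac

variable {N : ℕ} {A : Space → Space}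

theorem dirac_eq (j : Fin N) (u : Config N → Spin N) (x : Config N) :
    dirac A j u x = ∑ a : Fin 3, (spinActL j a)
      ((-Complex.I) • fderiv ℝ u x (Pi.single j (EuclideanSpace.single a 1))
        + ((A (x j) a : ℝ) : ℂ) • u x) := rfl

theorem dirac_add (j : Fin N) {u v : Config N → Spin N} {x : Config N}
    (hu : DifferentiableAt ℝ u x) (hv : DifferentiableAt ℝ v x) :
    dirac A j (u + v) x = dirac A j u x + dirac A j v x := by
  simp only [dirac_eq, ← Finset.sum_add_distrib, ← map_add]
  refine Finset.sum_congr rfl fun a _ => ?_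
  congr 1
  rw [fderiv_add hu hv]
  simp only [add_apply, Pi.add_apply, smul_add]
  abel

theorem dirac_smul (j : Fin N) (c : ℂ) {u : Config N → Spin N} {x : Config N}
    (hu : DifferentiableAt ℝ u x) : dirac A j (c • u) x = c • dirac A j u x := by
  simp only [dirac_eq, Finset.smul_sum, ← map_smul]
  refine Finset.sum_congr rfl fun a _ => ?_
  congr 1
  rw [fderiv_const_smul hu]
  simp only [smul_apply, Pi.smul_apply, smul_add]
  rw [smul_comm c, smul_comm c]

/-- The gradient of a real function in the position of particle `j`. -/
def grad (j : Fin N) (F : Config N → ℝ) (x : Config N) : Space :=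
  WithLp.toLp 2 fun a => fderiv ℝ F x (Pi.single j (EuclideanSpace.single a 1))

/-- The product rule `(σ · p) F u = F (σ · p) u - i (σ · ∇F) u`. -/
theorem dirac_mul (j : Fin N) {F : Config N → ℝ} {u : Config N → Spin N} {x : Config N}
    (hF : DifferentiableAt ℝ F x) (hu : DifferentiableAt ℝ u x) :
    dirac A j (fun y => F y • u y) x = F x • dirac A j u x
      + (-Complex.I) • spinVec j (fun a => ((grad j F x a : ℝ) : ℂ)) (u x) := by
  have hd : fderiv ℝ (fun y => F y • u y) x
      = F x • fderiv ℝ u x + (fderiv ℝ F x).smulRight (u x) := fderiv_fun_smul hF hu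
  rw [spinVec_apply, dirac_eq, dirac_eq, hd, Finset.smul_sum, Finset.smul_sum,
    ← Finset.sum_add_distrib]
  refine Finset.sum_congr rfl fun a _ => ?_
  simp only [add_apply, smul_apply,
    ContinuousLinearMap.smulRight_apply, grad, map_add, map_smul, spinActL_apply, smul_add,
    ← Complex.coe_smul (F x), ← Complex.coe_smul ((fderiv ℝ F x) _)]
  rw [smul_comm (-Complex.I) ((F x : ℝ) : ℂ), smul_comm ((A (x j) a : ℝ) : ℂ) ((F x : ℝ) : ℂ)]
  abel

theorem LocallySquareIntegrable.locallyIntegrable (hA : LocallySquareIntegrable A) :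
    LocallyIntegrable A := by
  rw [locallyIntegrable_iff]
  intro K hK
  have : IsFiniteMeasure (volume.restrict K) := ⟨by simpa using hK.measure_lt_top⟩
  exact (hA K hK).integrable (by norm_num)

theorem LocallySquareIntegrable.locallyIntegrable_sq (hA : LocallySquareIntegrable A) :
    LocallyIntegrable fun x => ‖A x‖ ^ 2 := by
  rw [locallyIntegrable_iff]
  intro K hK
  exact (hA K hK).integrable_norm_pow two_ne_zero

theorem memLp_dirac (hA : LocallySquareIntegrable A) (j : Fin N) {u : Config N → Spin N}
    (hu : ContDiff ℝ ∞ u) (hs : HasCompactSupport u) : MemLp (dirac A j u) 2 := by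
  have h1 : ∀ a : Fin 3,
      MemLp (fun x => fderiv ℝ u x (Pi.single j (EuclideanSpace.single a 1))) 2 := fun a => by
    refine Continuous.memLp_of_hasCompactSupport ?_ ?_
    · exact (hu.continuous_fderiv (by simp)).clm_apply continuous_const
    · exact hs.fderiv_apply ℝ _
  have hmeas : AEStronglyMeasurable (fun x : Config N => A (x j)) :=
    (locallyIntegrable_comp_eval hA.locallyIntegrable j).aestronglyMeasurable
  have hAu : MemLp (fun x => ‖A (x j)‖ * ‖u x‖) 2 := by
    refine (memLp_two_iff_integrable_sq
      (hmeas.norm.mul hu.continuous.norm.aestronglyMeasurable)).2 ?_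
    change Integrable fun x => (‖A (x j)‖ * ‖u x‖) ^ 2
    simp only [mul_pow]
    refine integrable_mul_of_hasCompactSupport
      (locallyIntegrable_comp_eval hA.locallyIntegrable_sq j) (hu.continuous.norm.pow 2) ?_
    exact hs.norm.comp_left (g := fun t : ℝ => t ^ 2) (by simp)
  have h2 : ∀ a : Fin 3, MemLp (fun x => ((A (x j) a : ℝ) : ℂ) • u x) 2 := fun a => by
    refine hAu.mono ?_ (Eventually.of_forall fun x => ?_)
    · have : Continuous fun y : Space => ((y a : ℝ) : ℂ) := by fun_prop
      exact (this.comp_aestronglyMeasurable hmeas).smul hu.continuous.aestronglyMeasurable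
    · rw [norm_smul, norm_mul, norm_norm, norm_norm, Complex.norm_real]
      gcongr
      exact PiLp.norm_apply_le (A (x j)) a
  have h3 : MemLp (fun x => ∑ a : Fin 3, (spinActL j a)
      ((-Complex.I) • fderiv ℝ u x (Pi.single j (EuclideanSpace.single a 1))
        + ((A (x j) a : ℝ) : ℂ) • u x)) 2 :=
    memLp_finsetSum _ fun a _ =>
      (spinActL j a).comp_memLp' (((h1 a).const_smul (-Complex.I)).add (h2 a))
  exact h3

end Dirac

/-! ### The core inside the Hilbert space -/

section Core

variable {N : ℕ} {st : Statistics}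

/-- The smooth compactly supported wave functions as a vector space. -/
def coreSubmodule (st : Statistics) (N : ℕ) : Submodule ℂ (Config N → Spin N) where
  carrier := core st N
  zero_mem' := by
    refine ⟨contDiff_const, HasCompactSupport.zero, fun x => ?_⟩
    cases st
    · intro π s; rfl
    · intro π s; simp
    · trivial
  add_mem' := by
    rintro u v ⟨hu1, hu2, hu3⟩ ⟨hv1, hv2, hv3⟩
    refine ⟨hu1.add hv1, hu2.add hv2, fun x => ?_⟩
    cases st
    · intro π s
      simp only [Pi.add_apply, PiLp.add_apply]
      rw [hu3 x π s, hv3 x π s]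
    · intro π s
      simp only [Pi.add_apply, PiLp.add_apply]
      rw [hu3 x π s, hv3 x π s, mul_add]
    · trivial
  smul_mem' := by
    rintro c u ⟨hu1, hu2, hu3⟩
    refine ⟨hu1.const_smul c, hu2.smul_left (f := fun _ => c), fun x => ?_⟩
    cases st
    · intro π s
      simp only [Pi.smul_apply, PiLp.smul_apply]
      rw [hu3 x π s]
    · intro π s
      simp only [Pi.smul_apply, PiLp.smul_apply, smul_eq_mul]
      rw [hu3 x π s]
      ring
    · trivial

/-- The core is stable under multiplication by smooth symmetric real functions. -/
theorem smul_mem_core {F : Config N → ℝ} (hF : ContDiff ℝ ∞ F)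
    (hsym : ∀ x (π : Equiv.Perm (Fin N)), F (x ∘ π) = F x) {u : Config N → Spin N}
    (hu : u ∈ core st N) : (fun x => F x • u x) ∈ core st N := by
  obtain ⟨h1, h2, h3⟩ := hu
  refine ⟨hF.smul h1, h2.smul_left (f := F), fun x => ?_⟩
  cases st
  · intro π s
    simp only [PiLp.smul_apply]
    rw [h3 x π s, hsym]
  · intro π s
    simp only [PiLp.smul_apply, Complex.real_smul]
    rw [h3 x π s, hsym]
    ring
  · trivial

theorem memLp_of_mem_core {u : Config N → Spin N} (hu : u ∈ core st N) : MemLp u 2 :=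
  hu.1.continuous.memLp_of_hasCompactSupport hu.2.1

theorem differentiable_of_mem_core {u : Config N → Spin N} (hu : u ∈ core st N) :
    Differentiable ℝ u :=
  hu.1.differentiable (by simp)

theorem symmetricAt_congr {u v : Config N → Spin N} {x : Config N} (h : u x = v x)
    (hπ : ∀ π : Equiv.Perm (Fin N), u (x ∘ π) = v (x ∘ π)) (hv : st.SymmetricAt v x) :
    st.SymmetricAt u x := by
  cases st
  · intro π s
    rw [h, hπ, hv π s]
  · intro π s
    rw [h, hπ, hv π s]
  · trivial

/-- The core as a subspace of the `N`-particle Hilbert space. -/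
def toHilbert (st : Statistics) (N : ℕ) : coreSubmodule st N →ₗ[ℂ] hilbert st N where
  toFun u := ⟨(memLp_of_mem_core u.2).toLp u, by
    have h0 := (memLp_of_mem_core u.2).coeFn_toLp
    show ∀ᵐ x, _
    filter_upwards [h0, ae_forall_perm h0] with x hx hπ
    exact symmetricAt_congr hx hπ (u.2.2.2 x)⟩
  map_add' u v := rfl
  map_smul' c u := rfl

theorem toHilbert_ae (u : coreSubmodule st N) :
    ((toHilbert st N u : L2 N) : Config N → Spin N) =ᵐ[volume] u :=
  (memLp_of_mem_core u.2).coeFn_toLp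

theorem inner_toHilbert (u : coreSubmodule st N) (η : hilbert st N) :
    ⟪toHilbert st N u, η⟫_ℂ = ∫ x, ⟪(u : Config N → Spin N) x, (η : L2 N) x⟫_ℂ := by
  rw [Submodule.coe_inner, L2.inner_def]
  refine integral_congr_ae ?_
  filter_upwards [toHilbert_ae u] with x hx
  rw [hx]

theorem norm_sq_eq_integral (f : L2 N) : ‖f‖ ^ 2 = ∫ x, ‖f x‖ ^ 2 := by
  have h : ⟪f, f⟫_ℂ = ((∫ x, ‖f x‖ ^ 2 : ℝ) : ℂ) := by
    rw [L2.inner_def]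
    refine Eq.trans ?_ integral_complex_ofReal
    refine integral_congr_ae (Eventually.of_forall fun x => ?_)
    simp only [inner_self_eq_norm_sq_to_K]
    simp
  rw [← inner_self_eq_norm_sq (𝕜 := ℂ) f, h]
  simp

theorem norm_sq_toHilbert (u : coreSubmodule st N) :
    ‖toHilbert st N u‖ ^ 2 = ∫ x, ‖(u : Config N → Spin N) x‖ ^ 2 := by
  rw [Submodule.coe_norm, norm_sq_eq_integral]
  refine integral_congr_ae ?_
  filter_upwards [toHilbert_ae u] with x hx
  rw [hx]

theorem tendsto_toHilbert_iff (u : ℕ → coreSubmodule st N) (ψ : hilbert st N) :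
    Tendsto (fun n => toHilbert st N (u n)) atTop (𝓝 ψ) ↔
      Tendsto (fun n => eLpNorm (fun x => (u n : Config N → Spin N) x - (ψ : L2 N) x) 2 volume)
        atTop (𝓝 0) := by
  rw [tendsto_subtype_rng, Lp.tendsto_Lp_iff_tendsto_eLpNorm']
  refine tendsto_congr fun n => eLpNorm_congr_ae ?_
  filter_upwards [toHilbert_ae (u n)] with x hx
  simp only [Pi.sub_apply]
  rw [hx]

theorem isClosed_hilbert (st : Statistics) (N : ℕ) : IsClosed (hilbert st N : Set (L2 N)) := by
  refine IsSeqClosed.isClosed fun f g hf hg => ?_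
  obtain ⟨ns, -, hns⟩ := (tendstoInMeasure_of_tendsto_Lp hg).exists_seq_tendsto_ae
  have hall : ∀ᵐ x, ∀ n, st.SymmetricAt (f n : Config N → Spin N) x :=
    ae_all_iff.2 fun n => hf n
  show ∀ᵐ x, st.SymmetricAt (g : Config N → Spin N) x
  filter_upwards [hns, ae_forall_perm hns, hall] with x h1 h2 h3
  have hco : ∀ {y : Config N} (s : Fin N → Fin 2),
      Tendsto (fun i => (f (ns i) : Config N → Spin N) y) atTop (𝓝 (g y)) →
      Tendsto (fun i => (f (ns i) : Config N → Spin N) y s) atTop (𝓝 (g y s)) := fun s h =>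
    ((EuclideanSpace.proj (𝕜 := ℂ) s).continuous.tendsto _).comp h
  cases st
  · intro π s
    refine tendsto_nhds_unique (hco (s ∘ π) (h2 π)) ?_
    simp only [fun i => h3 (ns i) π s]
    exact hco s h1
  · intro π s
    refine tendsto_nhds_unique (hco (s ∘ π) (h2 π)) ?_
    simp only [fun i => h3 (ns i) π s]
    exact (hco s h1).const_mul _
  · trivial

instance : CompleteSpace (hilbert st N) := (isClosed_hilbert st N).completeSpace_coe

end Core

/-! ### The quadratic form and the ground state energy -/

section Form

variable {N : ℕ} {st : Statistics} {A : Space → Space}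

theorem integrable_inner_of_memLp {u v : Config N → Spin N} (hu : MemLp u 2) (hv : MemLp v 2) :
    Integrable fun x => ⟪u x, v x⟫_ℂ := by
  refine (L2.integrable_inner (𝕜 := ℂ) (hu.toLp u) (hv.toLp v)).congr ?_
  filter_upwards [hu.coeFn_toLp, hv.coeFn_toLp] with x h1 h2
  rw [h1, h2]

theorem integrable_inner_dirac (hA : LocallySquareIntegrable A) (j : Fin N)
    {u v : Config N → Spin N} (hu : u ∈ core st N) (hv : v ∈ core st N) :
    Integrable fun x => ⟪dirac A j u x, dirac A j v x⟫_ℂ :=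
  integrable_inner_of_memLp (memLp_dirac hA j hu.1 hu.2.1) (memLp_dirac hA j hv.1 hv.2.1)

theorem integrable_coulomb_mul_inner (Z : ℝ) {u v : Config N → Spin N} (hu : u ∈ core st N)
    (hv : v ∈ core st N) :
    Integrable fun x => ((coulomb Z x : ℝ) : ℂ) * ⟪u x, v x⟫_ℂ := by
  have h1 : Continuous fun x => ⟪u x, v x⟫_ℂ := hu.1.continuous.inner hv.1.continuous
  have h2 : HasCompactSupport fun x => ⟪u x, v x⟫_ℂ := by
    refine hu.2.1.mono fun x hx => ?_
    contrapose! hx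
    simp only [Function.mem_support, ne_eq, not_not] at hx ⊢
    rw [hx, inner_zero_left]
  have := (locallyIntegrable_coulomb (N := N) Z).integrable_smul_right_of_hasCompactSupport h1 h2
  simpa only [Complex.real_smul] using this

theorem form_add_right (hA : LocallySquareIntegrable A) (Z : ℝ) {φ u v : Config N → Spin N}
    (hφ : φ ∈ core st N) (hu : u ∈ core st N) (hv : v ∈ core st N) :
    form A Z φ (u + v) = form A Z φ u + form A Z φ v := by
  have h1 : ∀ j, ∫ x, ⟪dirac A j φ x, dirac A j (u + v) x⟫_ℂ
      = (∫ x, ⟪dirac A j φ x, dirac A j u x⟫_ℂ) + ∫ x, ⟪dirac A j φ x, dirac A j v x⟫_ℂ :=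
    fun j => by
      rw [← integral_add (integrable_inner_dirac hA j hφ hu) (integrable_inner_dirac hA j hφ hv)]
      refine integral_congr_ae (Eventually.of_forall fun x => ?_)
      simp only [dirac_add j (differentiable_of_mem_core hu x) (differentiable_of_mem_core hv x),
        inner_add_right]
  have h2 : ∫ x, ((coulomb Z x : ℝ) : ℂ) * ⟪φ x, (u + v) x⟫_ℂ
      = (∫ x, ((coulomb Z x : ℝ) : ℂ) * ⟪φ x, u x⟫_ℂ)
        + ∫ x, ((coulomb Z x : ℝ) : ℂ) * ⟪φ x, v x⟫_ℂ := by
    rw [← integral_add (integrable_coulomb_mul_inner Z hφ hu)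
      (integrable_coulomb_mul_inner Z hφ hv)]
    refine integral_congr_ae (Eventually.of_forall fun x => ?_)
    simp only [Pi.add_apply, inner_add_right, mul_add]
  rw [form, form, form, h2, Finset.sum_congr rfl fun j _ => h1 j, Finset.sum_add_distrib]
  abel

theorem form_smul_right (Z : ℝ) (c : ℂ) (φ : Config N → Spin N) {u : Config N → Spin N}
    (hu : u ∈ core st N) : form A Z φ (c • u) = c * form A Z φ u := by
  have h1 : ∀ j, ∫ x, ⟪dirac A j φ x, dirac A j (c • u) x⟫_ℂ
      = c * ∫ x, ⟪dirac A j φ x, dirac A j u x⟫_ℂ := fun j => by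
    rw [← integral_const_mul]
    refine integral_congr_ae (Eventually.of_forall fun x => ?_)
    simp only [dirac_smul j c (differentiable_of_mem_core hu x), inner_smul_right]
  have h2 : ∫ x, ((coulomb Z x : ℝ) : ℂ) * ⟪φ x, (c • u) x⟫_ℂ
      = c * ∫ x, ((coulomb Z x : ℝ) : ℂ) * ⟪φ x, u x⟫_ℂ := by
    rw [← integral_const_mul]
    refine integral_congr_ae (Eventually.of_forall fun x => ?_)
    simp only [Pi.smul_apply, inner_smul_right]
    ring
  rw [form, form, h2, Finset.sum_congr rfl fun j _ => h1 j, ← Finset.mul_sum]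
  ring

theorem conj_form (Z : ℝ) (u v : Config N → Spin N) :
    (starRingEnd ℂ) (form A Z v u) = form A Z u v := by
  simp only [form, map_add, map_sum, ← integral_conj, map_mul, inner_conj_symm, Complex.conj_ofReal]

/-- The quadratic form of the Hamiltonian as a sesquilinear form on the core. -/
def formL (hA : LocallySquareIntegrable A) (st : Statistics) (N : ℕ) (Z : ℝ) :
    coreSubmodule st N →ₗ⋆[ℂ] coreSubmodule st N →ₗ[ℂ] ℂ :=
  LinearMap.mk₂'ₛₗ (starRingEnd ℂ) (RingHom.id ℂ) (fun φ ψ => form A Z (φ : Config N → Spin N) ψ)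
    (fun u v φ => by
      rw [← conj_form, Submodule.coe_add, form_add_right hA Z φ.2 u.2 v.2, map_add, conj_form,
        conj_form])
    (fun c u φ => by
      rw [← conj_form, Submodule.coe_smul, form_smul_right Z c _ u.2, map_mul, conj_form,
        smul_eq_mul])
    (fun φ u v => form_add_right hA Z φ.2 u.2 v.2)
    (fun c φ u => form_smul_right Z c _ u.2)

@[simp]
theorem formL_apply (hA : LocallySquareIntegrable A) (Z : ℝ) (u v : coreSubmodule st N) :
    formL hA st N Z u v = form A Z (u : Config N → Spin N) v := rfl

theorem hamiltonian_eq_formGraph (hA : LocallySquareIntegrable A) (Z : ℝ) :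
    hamiltonian st A N Z = formGraph (formL hA st N Z) (toHilbert st N) := by
  ext p
  constructor
  · rintro ⟨u, hu, h1, h2, h3⟩
    refine ⟨fun n => ⟨u n, hu n⟩, (tendsto_toHilbert_iff _ _).2 h1, h2, fun φ => ?_⟩
    rw [inner_toHilbert]
    exact h3 φ φ.2
  · rintro ⟨u, h1, h2, h3⟩
    refine ⟨fun n => u n, fun n => (u n).2, (tendsto_toHilbert_iff _ _).1 h1, h2, fun φ hφ => ?_⟩
    have := h3 ⟨φ, hφ⟩
    rwa [inner_toHilbert] at this

theorem conj_formL (hA : LocallySquareIntegrable A) (Z : ℝ) (u v : coreSubmodule st N) :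
    (starRingEnd ℂ) (formL hA st N Z v u) = formL hA st N Z u v :=
  conj_form Z _ _

/-- The ground state energy is a lower bound of the form. -/
theorem energy_mul_le (hA : LocallySquareIntegrable A) {Z : ℝ} (hb : BoundedBelow st A N Z)
    {u : Config N → Spin N} (hu : u ∈ core st N) :
    energy st A N Z * ∫ x, ‖u x‖ ^ 2 ≤ (form A Z u u).re := by
  obtain ⟨c, hc⟩ := hb
  have h := sInf_spec_formGraph_mul_le (b := formL hA st N Z) (J := toHilbert st N) (c := c)
    (conj_formL hA Z) (fun x => by rw [norm_sq_toHilbert]; exact hc x x.2) ⟨u, hu⟩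
  rwa [norm_sq_toHilbert, ← hamiltonian_eq_formGraph] at h

/-- A nonpositive lower bound of the form is a lower bound of the ground state energy. The sign
condition covers the junk value `0` of the infimum of an empty spectrum. -/
theorem le_energy (hA : LocallySquareIntegrable A) {Z c : ℝ} (hc0 : c ≤ 0)
    (hc : ∀ u ∈ core st N, c * ∫ x, ‖u x‖ ^ 2 ≤ (form A Z u u).re) : c ≤ energy st A N Z := by
  rw [energy, hamiltonian_eq_formGraph hA]
  refine Real.le_sInf (fun z hz => ?_) hc0
  exact le_of_mem_spec_formGraph (conj_formL hA Z)
    (fun x => by rw [norm_sq_toHilbert]; exact hc x x.2) hz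

end Form

/-! ### Decomposition of the Coulomb potential -/

section Coulomb

variable {N : ℕ}

/-- The potential `∑_i 1/|x_i|` of a nucleus of unit charge, up to sign. -/
def attraction (x : Config N) : ℝ := ∑ i, 1 / ‖x i‖

/-- The electron repulsion as half the sum over ordered pairs; the diagonal terms are
`1 / 0 = 0`. -/
def repulsion (x : Config N) : ℝ := (1 / 2) * ∑ i, ∑ j, 1 / ‖x i - x j‖

theorem attraction_nonneg (x : Config N) : 0 ≤ attraction x :=
  Finset.sum_nonneg fun _ _ => by positivity

theorem repulsion_nonneg (x : Config N) : 0 ≤ repulsion x :=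
  mul_nonneg (by norm_num) (Finset.sum_nonneg fun _ _ => Finset.sum_nonneg fun _ _ => by positivity)

theorem coulomb_eq (Z : ℝ) (x : Config N) : coulomb Z x = -(Z * attraction x) + repulsion x := by
  have h1 : ∑ i, Z / ‖x i‖ = Z * attraction x := by
    rw [attraction, Finset.mul_sum]
    exact Finset.sum_congr rfl fun i _ => by ring
  have h2 := Finset.sum_sum_Ioi_add_eq_sum_sum_off_diag fun i j => 1 / ‖x i - x j‖
  have h3 : ∀ i, ∑ j, 1 / ‖x i - x j‖ = ∑ j ∈ {i}ᶜ, 1 / ‖x j - x i‖ := fun i => by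
    rw [← Finset.sum_compl_add_sum {i}]
    simp [norm_sub_rev]
  have h4 : ∀ i j, 1 / ‖x j - x i‖ + 1 / ‖x i - x j‖ = 2 * (1 / ‖x i - x j‖) := fun i j => by
    rw [norm_sub_rev]; ring
  simp only [h4, ← Finset.mul_sum] at h2
  rw [coulomb, repulsion, h1, Finset.sum_congr rfl fun i _ => h3 i, ← h2]
  ring

theorem attraction_succAbove {M : ℕ} (i : Fin (M + 1)) (x : Config (M + 1)) :
    attraction x = 1 / ‖x i‖ + attraction (x ∘ i.succAbove) := by
  rw [attraction, Fin.sum_univ_succAbove _ i]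
  rfl

theorem repulsion_succAbove {M : ℕ} (i : Fin (M + 1)) (x : Config (M + 1)) :
    repulsion x = (∑ j, 1 / ‖x i - x j‖) + repulsion (x ∘ i.succAbove) := by
  have h1 : ∀ k, ∑ j, 1 / ‖x k - x j‖
      = 1 / ‖x i - x k‖ + ∑ j : Fin M, 1 / ‖x k - x (i.succAbove j)‖ := fun k => by
    rw [Fin.sum_univ_succAbove _ i, norm_sub_rev]
  rw [repulsion, repulsion, Fin.sum_univ_succAbove _ i]
  simp only [h1, Finset.sum_add_distrib, Function.comp_apply]
  simp
  ring

end Coulomb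

/-! ### Freezing one particle -/

section Slice

variable {M : ℕ}

/-- The component of a spinor in which the spin of particle `i` has the value `σ`. -/
def restrictSpin (i : Fin (M + 1)) (σ : Fin 2) : Spin (M + 1) →L[ℂ] Spin M :=
  LinearMap.toContinuousLinearMap
    { toFun := fun v => WithLp.toLp 2 fun s => v (i.insertNth σ s)
      map_add' := fun _ _ => rfl
      map_smul' := fun _ _ => rfl }

theorem restrictSpin_apply (i : Fin (M + 1)) (σ : Fin 2) (v : Spin (M + 1)) (s : Fin M → Fin 2) :
    restrictSpin i σ v s = v (i.insertNth σ s) := rfl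

theorem sum_norm_sq_restrictSpin (i : Fin (M + 1)) (v : Spin (M + 1)) :
    ∑ σ, ‖restrictSpin i σ v‖ ^ 2 = ‖v‖ ^ 2 := by
  simp only [EuclideanSpace.norm_sq_eq, restrictSpin_apply]
  rw [← Fintype.sum_prod_type']
  exact (Fin.insertNthEquiv (fun _ : Fin (M + 1) => Fin 2) i).sum_comp fun s => ‖v s‖ ^ 2

theorem spinAct_restrictSpin (i : Fin (M + 1)) (σ : Fin 2) (j : Fin M) (a : Fin 3)
    (v : Spin (M + 1)) :
    spinAct j a (restrictSpin i σ v) = restrictSpin i σ (spinAct (i.succAbove j) a v) := by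
  ext s
  simp only [spinAct, restrictSpin_apply, Fin.insertNth_apply_succAbove, Fin.insertNth_update]

/-- The wave function of the other particles when particle `i` has position `y` and spin `σ`. -/
def slice (i : Fin (M + 1)) (y : Space) (σ : Fin 2) (u : Config (M + 1) → Spin (M + 1)) :
    Config M → Spin M :=
  fun x => restrictSpin i σ (u (i.insertNth y x))

/-- The differential of `x ↦ Fin.insertNth i y x`. -/
def insertL (i : Fin (M + 1)) : Config M →L[ℝ] Config (M + 1) :=
  LinearMap.toContinuousLinearMap
    { toFun := fun x => i.insertNth (0 : Space) x
      map_add' := fun x x' => by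
        ext k : 1
        refine Fin.succAboveCases i ?_ (fun k => ?_) k <;> simp
      map_smul' := fun c x => by
        ext k : 1
        refine Fin.succAboveCases i ?_ (fun k => ?_) k <;> simp }

theorem insertNth_eq_add (i : Fin (M + 1)) (y : Space) :
    (fun x : Config M => (i.insertNth y x : Config (M + 1)))
      = fun x => i.insertNth y 0 + insertL i x := by
  ext x k : 2
  change _ = (i.insertNth y 0 : Config (M + 1)) k + (i.insertNth 0 x : Config (M + 1)) k
  refine Fin.succAboveCases i ?_ (fun k => ?_) k <;> simp

theorem insertL_single (i : Fin (M + 1)) (j : Fin M) (e : Space) :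
    insertL i (Pi.single j e) = Pi.single (i.succAbove j) e := by
  ext k : 1
  change (i.insertNth 0 (Pi.single j e) : Config (M + 1)) k = _
  refine Fin.succAboveCases i ?_ (fun k => ?_) k
  · simp [Fin.ne_succAbove]
  · rw [Fin.insertNth_apply_succAbove]
    rcases eq_or_ne k j with rfl | hk
    · simp
    · simp [hk]

theorem contDiff_insertNth (i : Fin (M + 1)) (y : Space) :
    ContDiff ℝ ∞ fun x : Config M => (i.insertNth y x : Config (M + 1)) := by
  rw [insertNth_eq_add]
  exact contDiff_const.add (insertL i).contDiff

/-- The permutation of all particles that fixes `i` and permutes the others by `π`. -/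
def extendPerm (i : Fin (M + 1)) (π : Equiv.Perm (Fin M)) : Equiv.Perm (Fin (M + 1)) :=
  (finSuccEquiv' i).symm.permCongr (Equiv.optionCongr π)

theorem extendPerm_self (i : Fin (M + 1)) (π : Equiv.Perm (Fin M)) : extendPerm i π i = i := by
  simp [extendPerm, Equiv.permCongr_apply]

theorem extendPerm_succAbove (i : Fin (M + 1)) (π : Equiv.Perm (Fin M)) (j : Fin M) :
    extendPerm i π (i.succAbove j) = i.succAbove (π j) := by
  simp [extendPerm, Equiv.permCongr_apply]

theorem sign_extendPerm (i : Fin (M + 1)) (π : Equiv.Perm (Fin M)) :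
    Equiv.Perm.sign (extendPerm i π) = Equiv.Perm.sign π := by
  rw [extendPerm, Equiv.Perm.sign_permCongr, Equiv.optionCongr_sign]

theorem insertNth_comp_extendPerm {α : Type*} (i : Fin (M + 1)) (π : Equiv.Perm (Fin M)) (y : α)
    (x : Fin M → α) :
    (i.insertNth y x : Fin (M + 1) → α) ∘ extendPerm i π = i.insertNth y (x ∘ π) := by
  ext k : 1
  rw [Function.comp_apply]
  refine Fin.succAboveCases i ?_ (fun k => ?_) k
  · simp [extendPerm_self]
  · simp [extendPerm_succAbove]

theorem slice_mem_core {st : Statistics} (i : Fin (M + 1)) (y : Space) (σ : Fin 2)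
    {u : Config (M + 1) → Spin (M + 1)} (hu : u ∈ core st (M + 1)) :
    slice i y σ u ∈ core st M := by
  obtain ⟨h1, h2, h3⟩ := hu
  refine ⟨?_, ?_, fun x => ?_⟩
  · exact ((restrictSpin i σ).restrictScalars ℝ).contDiff.comp (h1.comp (contDiff_insertNth i y))
  · have hK : IsCompact ((fun x : Config (M + 1) => x ∘ i.succAbove) '' tsupport u) :=
      h2.isCompact.image (by fun_prop)
    refine HasCompactSupport.intro hK fun x hx => ?_
    have : (i.insertNth y x : Config (M + 1)) ∉ tsupport u := fun h =>
      hx ⟨_, h, by ext k : 1; simp⟩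
    rw [slice, image_eq_zero_of_notMem_tsupport this, map_zero]
  · cases st
    · intro π s
      have := h3 (i.insertNth y x) (extendPerm i π) (i.insertNth σ s)
      simp only [insertNth_comp_extendPerm] at this
      exact this
    · intro π s
      have := h3 (i.insertNth y x) (extendPerm i π) (i.insertNth σ s)
      simp only [insertNth_comp_extendPerm, sign_extendPerm] at this
      exact this
    · trivial

theorem dirac_slice {A : Space → Space} (i : Fin (M + 1)) (y : Space) (σ : Fin 2) (j : Fin M)
    {u : Config (M + 1) → Spin (M + 1)} (hu : Differentiable ℝ u) (x : Config M) :
    dirac A j (slice i y σ u) x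
      = restrictSpin i σ (dirac A (i.succAbove j) u (i.insertNth y x)) := by
  have hins : HasFDerivAt (fun x : Config M => (i.insertNth y x : Config (M + 1)))
      (insertL i) x := by
    rw [insertNth_eq_add]
    exact (insertL i).hasFDerivAt.const_add _
  have hd : HasFDerivAt (slice i y σ u)
      (((restrictSpin i σ).restrictScalars ℝ).comp
        ((fderiv ℝ u (i.insertNth y x)).comp (insertL i))) x :=
    ((restrictSpin i σ).restrictScalars ℝ).hasFDerivAt.comp x
      ((hu _).hasFDerivAt.comp x hins)
  rw [dirac, dirac, map_sum]
  refine Finset.sum_congr rfl fun a _ => ?_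
  rw [← spinAct_restrictSpin, momentum, momentum, hd.fderiv]
  simp only [ContinuousLinearMap.comp_apply, insertL_single, map_add, map_smul,
    Fin.insertNth_apply_succAbove]
  rfl

end Slice

section Fubini

variable {M : ℕ} {E : Type*} [NormedAddCommGroup E] [NormedSpace ℝ E]

theorem measurePreserving_insertNth (i : Fin (M + 1)) :
    MeasurePreserving (fun p : Space × Config M => (i.insertNth p.1 p.2 : Config (M + 1)))
      (volume.prod volume) volume :=
  (volume_preserving_piFinSuccAbove (fun _ : Fin (M + 1) => Space) i).symm

theorem integral_eq_integral_insertNth (i : Fin (M + 1)) {G : Config (M + 1) → E}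
    (hG : Integrable G) : ∫ x, G x = ∫ y, ∫ x', G (i.insertNth y x') := by
  let e := (MeasurableEquiv.piFinSuccAbove (fun _ : Fin (M + 1) => Space) i).symm
  have he : MeasurePreserving e (volume.prod volume) volume := measurePreserving_insertNth i
  rw [← he.integral_comp e.measurableEmbedding, integral_prod]
  · rfl
  · exact (he.integrable_comp_emb e.measurableEmbedding).2 hG

end Fubini

section SliceForm

variable {A : Space → Space} {st : Statistics}

theorem integrable_norm_sq_dirac {N : ℕ} (hA : LocallySquareIntegrable A) (j : Fin N)
    {u : Config N → Spin N} (hu : u ∈ core st N) : Integrable fun x => ‖dirac A j u x‖ ^ 2 :=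
  (memLp_dirac hA j hu.1 hu.2.1).integrable_norm_pow two_ne_zero

theorem integrable_mul_norm_sq {N : ℕ} {V : Config N → ℝ} (hV : LocallyIntegrable V)
    {u : Config N → Spin N} (hu : u ∈ core st N) : Integrable fun x => V x * ‖u x‖ ^ 2 :=
  integrable_mul_of_hasCompactSupport hV (hu.1.continuous.norm.pow 2)
    (hu.2.1.norm.comp_left (g := fun t : ℝ => t ^ 2) (by simp))

theorem integrable_norm_sq {N : ℕ} {u : Config N → Spin N} (hu : u ∈ core st N) :
    Integrable fun x => ‖u x‖ ^ 2 :=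
  (memLp_of_mem_core hu).integrable_norm_pow two_ne_zero

theorem re_form_self {N : ℕ} (Z : ℝ) {u : Config N → Spin N} :
    (form A Z u u).re = ∑ j, (∫ x, ‖dirac A j u x‖ ^ 2) + ∫ x, coulomb Z x * ‖u x‖ ^ 2 := by
  have hin : ∀ v : Spin N, ⟪v, v⟫_ℂ = ((‖v‖ ^ 2 : ℝ) : ℂ) := fun v => by
    rw [inner_self_eq_norm_sq_to_K]; simp
  simp only [form, hin, ← Complex.ofReal_mul, integral_complex_ofReal, ← Complex.ofReal_sum,
    ← Complex.ofReal_add, Complex.ofReal_re]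

/-- A lower bound of the `M`-particle form, applied to the other particles at each position and
spin of particle `i` and integrated against a weight in `x i`. -/
theorem weighted_form_le (hA : LocallySquareIntegrable A) {M : ℕ} {c Z : ℝ}
    (hc : ∀ v ∈ core st M, c * ∫ x, ‖v x‖ ^ 2 ≤ (form A Z v v).re)
    {g : Space → ℝ} (hg : Continuous g) (hg0 : ∀ y, 0 ≤ g y) {K : ℝ} (hgK : ∀ y, g y ≤ K)
    {u : Config (M + 1) → Spin (M + 1)} (hu : u ∈ core st (M + 1)) (i : Fin (M + 1)) :
    c * ∫ x, g (x i) * ‖u x‖ ^ 2 ≤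
      ∑ j : Fin M, (∫ x, g (x i) * ‖dirac A (i.succAbove j) u x‖ ^ 2)
        + ∫ x, g (x i) * (coulomb Z (x ∘ i.succAbove) * ‖u x‖ ^ 2) := by
  have hbdd : ∀ {h : Config (M + 1) → ℝ}, Integrable h → Integrable fun x => g (x i) * h x :=
    fun hh => hh.bdd_mul (c := K) (hg.comp (continuous_apply i)).aestronglyMeasurable
      (Eventually.of_forall fun x => by rw [Real.norm_of_nonneg (hg0 _)]; exact hgK _)
  have hI1 := fun j => hbdd (integrable_norm_sq_dirac hA (i.succAbove j) hu)
  have hI2 := hbdd (integrable_mul_norm_sq (locallyIntegrable_coulomb_comp i.succAbove Z) hu)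
  have hI3 := hbdd (integrable_norm_sq hu)
  have hI1' := integrable_finsetSum Finset.univ fun j _ => hI1 j
  have hI : Integrable fun x => ∑ j, g (x i) * ‖dirac A (i.succAbove j) u x‖ ^ 2
      + g (x i) * (coulomb Z (x ∘ i.succAbove) * ‖u x‖ ^ 2) := hI1'.add hI2
  have hI' : Integrable fun x => ∑ j, g (x i) * ‖dirac A (i.succAbove j) u x‖ ^ 2
      + g (x i) * (coulomb Z (x ∘ i.succAbove) * ‖u x‖ ^ 2) - c * (g (x i) * ‖u x‖ ^ 2) :=
    hI.sub (hI3.const_mul c)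
  rw [← sub_nonneg, ← integral_const_mul, ← integral_finsetSum _ fun j _ => hI1 j,
    ← integral_add hI1' hI2, ← integral_sub hI (hI3.const_mul c),
    integral_eq_integral_insertNth i hI']
  refine integral_nonneg fun y => ?_
  simp only [Fin.insertNth_apply_same]
  have hcomp : ∀ x' : Config M, (i.insertNth y x' : Config (M + 1)) ∘ i.succAbove = x' :=
    fun x' => by ext k : 1; simp
  have hσ : ∀ σ, 0 ≤ ∫ x', (∑ j, ‖dirac A j (slice i y σ u) x'‖ ^ 2
      + coulomb Z x' * ‖slice i y σ u x'‖ ^ 2 - c * ‖slice i y σ u x'‖ ^ 2) := fun σ => by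
    have hv := slice_mem_core i y σ hu
    have h1 := integrable_finsetSum Finset.univ fun j _ => integrable_norm_sq_dirac hA j hv
    have h2 := integrable_mul_norm_sq (locallyIntegrable_coulomb Z) hv
    have h3 := integrable_norm_sq hv
    have h4 := hc _ hv
    rw [re_form_self] at h4
    have h12 : Integrable fun x' => ∑ j, ‖dirac A j (slice i y σ u) x'‖ ^ 2
        + coulomb Z x' * ‖slice i y σ u x'‖ ^ 2 := h1.add h2
    rw [integral_sub h12 (h3.const_mul c), integral_add h1 h2, integral_const_mul,
      integral_finsetSum _ fun j _ => integrable_norm_sq_dirac hA j hv]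
    linarith
  have hint : ∀ σ, Integrable fun x' => (∑ j, ‖dirac A j (slice i y σ u) x'‖ ^ 2
      + coulomb Z x' * ‖slice i y σ u x'‖ ^ 2 - c * ‖slice i y σ u x'‖ ^ 2) := fun σ => by
    have hv := slice_mem_core i y σ hu
    have h1 := integrable_finsetSum Finset.univ fun j _ => integrable_norm_sq_dirac hA j hv
    exact (h1.add (integrable_mul_norm_sq (locallyIntegrable_coulomb Z) hv)).sub
      ((integrable_norm_sq hv).const_mul c)
  have hsum := mul_nonneg (hg0 y) (Finset.sum_nonneg fun σ (_ : σ ∈ Finset.univ) => hσ σ)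
  rw [← integral_finsetSum _ fun σ _ => hint σ, ← integral_const_mul] at hsum
  refine hsum.trans_eq (integral_congr_ae (Eventually.of_forall fun x' => ?_))
  simp only [hcomp, Finset.sum_sub_distrib, Finset.sum_add_distrib, ← Finset.mul_sum]
  rw [Finset.sum_comm]
  simp only [dirac_slice i y _ _ (differentiable_of_mem_core hu), sum_norm_sq_restrictSpin]
  have : ∑ σ, ‖slice i y σ u x'‖ ^ 2 = ‖u (i.insertNth y x')‖ ^ 2 :=
    sum_norm_sq_restrictSpin i _
  rw [this]
  ring

end SliceForm

/-! ### Many-body lower bounds from the one-particle form -/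

section Energies

variable {N : ℕ} {st : Statistics} {A : Space → Space}

theorem locallyIntegrable_attraction : LocallyIntegrable fun x : Config N => attraction x :=
  locallyIntegrable_finsetSum _ fun i _ => locallyIntegrable_inv_norm_eval i

theorem locallyIntegrable_repulsion : LocallyIntegrable fun x : Config N => repulsion x := by
  have : LocallyIntegrable fun x : Config N => ∑ i, ∑ j, 1 / ‖x i - x j‖ :=
    locallyIntegrable_finsetSum _ fun i _ => locallyIntegrable_finsetSum _ fun j _ =>
      locallyIntegrable_inv_norm_sub i j
  exact this.smul (1 / 2 : ℝ)

theorem re_form_eq (Z : ℝ) {u : Config N → Spin N} (hu : u ∈ core st N) :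
    (form A Z u u).re = ∑ j, (∫ x, ‖dirac A j u x‖ ^ 2) - Z * (∫ x, attraction x * ‖u x‖ ^ 2)
      + ∫ x, repulsion x * ‖u x‖ ^ 2 := by
  have h : ∫ x, coulomb Z x * ‖u x‖ ^ 2
      = -(Z * (∫ x, attraction x * ‖u x‖ ^ 2)) + ∫ x, repulsion x * ‖u x‖ ^ 2 := by
    rw [← integral_const_mul, ← integral_neg, ← integral_add]
    · refine integral_congr_ae (Eventually.of_forall fun x => ?_)
      simp only [coulomb_eq]
      ring
    · exact ((integrable_mul_norm_sq locallyIntegrable_attraction hu).const_mul Z).neg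
    · exact integrable_mul_norm_sq locallyIntegrable_repulsion hu
  rw [re_form_self, h]
  ring

theorem sum_sum_succAbove {M : ℕ} (g : Fin (M + 1) → ℝ) :
    ∑ i, ∑ j : Fin M, g (Fin.succAbove i j) = M * ∑ i, g i := by
  have h : ∀ i : Fin (M + 1), ∑ j : Fin M, g (Fin.succAbove i j) = ∑ k, g k - g i := fun i => by
    rw [Fin.sum_univ_succAbove g i]
    ring
  rw [Finset.sum_congr rfl fun i _ => h i, Finset.sum_sub_distrib]
  simp
  ring

theorem sum_coulomb_succAbove_le {M : ℕ} (Z : ℝ) (x : Config (M + 1)) :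
    ∑ i : Fin (M + 1), coulomb Z (x ∘ i.succAbove) ≤ M * coulomb Z x := by
  have h1 : ∀ i : Fin (M + 1), coulomb Z (x ∘ i.succAbove)
      = coulomb Z x + Z * (1 / ‖x i‖) - ∑ j, 1 / ‖x i - x j‖ := fun i => by
    rw [coulomb_eq, coulomb_eq, attraction_succAbove i x, repulsion_succAbove i x]
    ring
  have h2 : ∑ i, ∑ j, 1 / ‖x i - x j‖ = 2 * repulsion x := by
    rw [repulsion]; ring
  have h3 : ∑ i, 1 / ‖x i‖ = attraction x := rfl
  rw [Finset.sum_congr rfl fun i _ => h1 i, Finset.sum_sub_distrib, Finset.sum_add_distrib,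
    ← Finset.mul_sum, h2, h3, Finset.sum_const, Finset.card_univ, Fintype.card_fin, nsmul_eq_mul]
  have := repulsion_nonneg x
  rw [coulomb_eq]
  push_cast
  nlinarith

/-- Since the repulsion is positive, the form of `M + 1` particles is bounded below by `M + 1` times
a bound for one particle. The induction averages over the particle that is left out. -/
theorem nbody_lower_bound (hA : LocallySquareIntegrable A) {c Z : ℝ}
    (hc : ∀ v ∈ core st 1, c * ∫ x, ‖v x‖ ^ 2 ≤ (form A Z v v).re) (M : ℕ) :
    ∀ u ∈ core st (M + 1), ((M + 1 : ℕ) : ℝ) * c * ∫ x, ‖u x‖ ^ 2 ≤ (form A Z u u).re := by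
  induction M with
  | zero => simpa using hc
  | succ M ih =>
    intro u hu
    have h1 : ∀ i : Fin (M + 2), _ := fun i => weighted_form_le hA ih (g := fun _ => 1)
      continuous_const (fun _ => zero_le_one) (K := 1) (fun _ => le_rfl) hu i
    simp only [one_mul] at h1
    have h2 := Finset.sum_le_sum fun i (_ : i ∈ Finset.univ) => h1 i
    have hI : ∀ i : Fin (M + 2), Integrable fun x => coulomb Z (x ∘ i.succAbove) * ‖u x‖ ^ 2 :=
      fun i => integrable_mul_norm_sq (locallyIntegrable_coulomb_comp i.succAbove Z) hu
    rw [Finset.sum_add_distrib, sum_sum_succAbove fun i => ∫ x, ‖dirac A i u x‖ ^ 2,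
      ← integral_finsetSum _ fun i _ => hI i] at h2
    have h3 : ∫ x, ∑ i : Fin (M + 2), coulomb Z (x ∘ i.succAbove) * ‖u x‖ ^ 2
        ≤ ((M + 1 : ℕ) : ℝ) * ∫ x, coulomb Z x * ‖u x‖ ^ 2 := by
      rw [← integral_const_mul]
      refine integral_mono (integrable_finsetSum _ fun i _ => hI i)
        ((integrable_mul_norm_sq (locallyIntegrable_coulomb Z) hu).const_mul _) fun x => ?_
      simp only
      rw [← Finset.sum_mul, ← mul_assoc]
      gcongr
      exact sum_coulomb_succAbove_le Z x
    rw [re_form_self]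
    simp only [Finset.sum_const, Finset.card_univ, Fintype.card_fin, nsmul_eq_mul] at h2
    have hM : (0 : ℝ) < ((M + 1 : ℕ) : ℝ) := by positivity
    refine le_of_mul_le_mul_left ?_ hM
    push_cast at *
    linarith

end Energies

/-! ### The weight function -/

section Weight

/-- A smooth bounded substitute `f` for the weight `|x|`. The condition on `∇f` is what the Pauli
kinetic energy needs: it holds for `|x|` because `|∇|x||² = 1 = |x| · 1/|x|`. -/
structure LiebWeight (f : Space → ℝ) (K ε : ℝ) : Prop where
  contDiff : ContDiff ℝ ∞ f
  nonneg : ∀ y, 0 ≤ f y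
  le_bound : ∀ y, f y ≤ K
  norm_fderiv_le : ∀ y, ‖fderiv ℝ f y‖ ≤ 1
  sq_norm_fderiv_le : ∀ y, ‖fderiv ℝ f y‖ ^ 2 ≤ f y * (1 / ‖y‖)
  le_add : ∀ y, f y ≤ ‖y‖ + ε

/-- The weight `s / (1 + δ s)` with `s = √(|x|² + δ²)`. -/
def liebWeight (δ : ℝ) (y : Space) : ℝ :=
  √(‖y‖ ^ 2 + δ ^ 2) / (1 + δ * √(‖y‖ ^ 2 + δ ^ 2))

theorem liebWeight_spec {δ : ℝ} (hδ : 0 < δ) : LiebWeight (liebWeight δ) δ⁻¹ δ := by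
  have hpos : ∀ y : Space, 0 < ‖y‖ ^ 2 + δ ^ 2 := fun y => by positivity
  have hs : ∀ y : Space, 0 < √(‖y‖ ^ 2 + δ ^ 2) := fun y => Real.sqrt_pos.2 (hpos y)
  have hys : ∀ y : Space, ‖y‖ ≤ √(‖y‖ ^ 2 + δ ^ 2) := fun y =>
    Real.le_sqrt_of_sq_le (by linarith [sq_nonneg δ])
  have hden : ∀ y : Space, 1 ≤ 1 + δ * √(‖y‖ ^ 2 + δ ^ 2) := fun y => by
    have := mul_pos hδ (hs y)
    linarith
  have hfd : ∀ y : Space, ‖fderiv ℝ (liebWeight δ) y‖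
      ≤ 1 / (1 + δ * √(‖y‖ ^ 2 + δ ^ 2)) ^ 2 * (‖y‖ / √(‖y‖ ^ 2 + δ ^ 2)) := fun y => by
    set s := √(‖y‖ ^ 2 + δ ^ 2) with hsdef
    have h1 : HasFDerivAt (fun y : Space => ‖y‖ ^ 2 + δ ^ 2) (2 • innerSL ℝ y) y :=
      (hasStrictFDerivAt_norm_sq y).hasFDerivAt.add_const _
    have h2 := h1.sqrt (hpos y).ne'
    have h3 : HasDerivAt (fun t : ℝ => t / (1 + δ * t)) (1 / (1 + δ * s) ^ 2) s := by
      have h4 : HasDerivAt (fun t : ℝ => 1 + δ * t) δ s := by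
        simpa using ((hasDerivAt_id s).const_mul δ).const_add 1
      have h5 := (hasDerivAt_id s).div h4 (by linarith [hden y])
      convert! h5 using 1
      simp only [id]
      ring
    have h4 := HasDerivAt.comp_hasFDerivAt (h₂ := fun t : ℝ => t / (1 + δ * t)) y h3 h2
    have hcomp : liebWeight δ = (fun t : ℝ => t / (1 + δ * t)) ∘ fun y : Space =>
        √(‖y‖ ^ 2 + δ ^ 2) := rfl
    rw [hcomp, h4.fderiv, norm_smul, norm_smul, Real.norm_of_nonneg (by positivity),
      Real.norm_of_nonneg (by positivity), ← hsdef]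
    have h5 : ‖2 • innerSL ℝ y‖ = 2 * ‖y‖ := by
      rw [← Nat.cast_smul_eq_nsmul ℝ, norm_smul, innerSL_apply_norm]
      simp
    rw [h5]
    apply le_of_eq
    have := (hs y).ne'
    field_simp
  have hratio : ∀ y : Space, ‖y‖ / √(‖y‖ ^ 2 + δ ^ 2) ≤ 1 := fun y =>
    (div_le_one (hs y)).2 (hys y)
  have hfd' : ∀ y : Space, ‖fderiv ℝ (liebWeight δ) y‖ ≤ 1 / (1 + δ * √(‖y‖ ^ 2 + δ ^ 2)) :=
    fun y => by
      have h0 := hden y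
      calc _ ≤ _ := hfd y
        _ ≤ 1 / (1 + δ * √(‖y‖ ^ 2 + δ ^ 2)) ^ 2 * 1 := by gcongr; exact hratio y
        _ ≤ 1 / (1 + δ * √(‖y‖ ^ 2 + δ ^ 2)) := by
          rw [mul_one]
          apply one_div_le_one_div_of_le (by linarith)
          nlinarith
  refine ⟨?_, fun y => ?_, fun y => ?_, fun y => ?_, fun y => ?_, fun y => ?_⟩
  · have h1 : ContDiff ℝ ∞ fun y : Space => √(‖y‖ ^ 2 + δ ^ 2) :=
      ((contDiff_norm_sq ℝ).add contDiff_const).sqrt fun y => (hpos y).ne'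
    exact h1.div (contDiff_const.add (contDiff_const.mul h1)) fun y => by linarith [hden y]
  · exact div_nonneg (hs y).le (by linarith [hden y])
  · rw [liebWeight, div_le_iff₀ (by linarith [hden y]), mul_add, inv_mul_cancel_left₀ hδ.ne']
    have := inv_pos.2 hδ
    linarith
  · refine (hfd' y).trans ?_
    rw [div_le_one (by linarith [hden y])]
    exact hden y
  · rcases eq_or_ne y 0 with rfl | hy
    · have := hfd 0
      simp only [norm_zero, zero_div, mul_zero] at this
      have h0 : ‖fderiv ℝ (liebWeight δ) 0‖ = 0 := le_antisymm this (norm_nonneg _)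
      rw [h0]
      simp
    · have hy0 : 0 < ‖y‖ := norm_pos_iff.2 hy
      have h0 := hden y
      have h1 : 1 / (1 + δ * √(‖y‖ ^ 2 + δ ^ 2)) ≤ 1 := by
        rw [div_le_one (by linarith)]
        exact h0
      have h2 : 0 ≤ 1 / (1 + δ * √(‖y‖ ^ 2 + δ ^ 2)) := by positivity
      calc ‖fderiv ℝ (liebWeight δ) y‖ ^ 2 ≤ (1 / (1 + δ * √(‖y‖ ^ 2 + δ ^ 2))) ^ 2 := by
            gcongr
            exact hfd' y
        _ ≤ 1 / (1 + δ * √(‖y‖ ^ 2 + δ ^ 2)) := by nlinarith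
        _ ≤ 1 / (1 + δ * √(‖y‖ ^ 2 + δ ^ 2)) * (√(‖y‖ ^ 2 + δ ^ 2) * (1 / ‖y‖)) := by
            refine le_mul_of_one_le_right h2 ?_
            rw [mul_one_div, one_le_div hy0]
            exact hys y
        _ = liebWeight δ y * (1 / ‖y‖) := by rw [liebWeight]; ring
  · have h1 : √(‖y‖ ^ 2 + δ ^ 2) ≤ ‖y‖ + δ := by
      rw [Real.sqrt_le_left (by positivity)]
      nlinarith [norm_nonneg y]
    exact (div_le_self (hs y).le (hden y)).trans h1

theorem tendsto_liebWeight (y : Space) :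
    Tendsto (fun n : ℕ => liebWeight (1 / ((n : ℝ) + 1)) y) atTop (𝓝 ‖y‖) := by
  have h0 := tendsto_one_div_add_atTop_nhds_zero_nat (𝕜 := ℝ)
  have h1 : Tendsto (fun n : ℕ => √(‖y‖ ^ 2 + (1 / ((n : ℝ) + 1)) ^ 2)) atTop (𝓝 ‖y‖) := by
    have := ((h0.pow 2).const_add (‖y‖ ^ 2)).sqrt
    simpa [Real.sqrt_sq (norm_nonneg y)] using this
  have h2 := h1.div ((h0.mul h1).const_add 1) (by simp)
  simp only [zero_mul, add_zero, div_one] at h2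
  refine h2.congr fun n => ?_
  simp [liebWeight]

end Weight

/-! ### The weighted kinetic energy -/

section Kinetic

variable {N : ℕ} {st : Statistics} {A : Space → Space} {f : Space → ℝ} {K ε : ℝ}

/-- The symmetric multiplier `∑_i f(x_i)`. -/
def totalWeight (f : Space → ℝ) (x : Config N) : ℝ := ∑ i, f (x i)

theorem contDiff_totalWeight (hf : ContDiff ℝ ∞ f) :
    ContDiff ℝ ∞ (totalWeight f : Config N → ℝ) :=
  ContDiff.sum fun i _ => hf.comp (contDiff_apply ℝ Space i)

theorem totalWeight_comp_perm (x : Config N) (π : Equiv.Perm (Fin N)) :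
    totalWeight f (x ∘ π) = totalWeight f x :=
  Equiv.sum_comp π fun i => f (x i)

theorem totalWeight_nonneg (hw : LiebWeight f K ε) (x : Config N) : 0 ≤ totalWeight f x :=
  Finset.sum_nonneg fun _ _ => hw.nonneg _

theorem totalWeight_le (hw : LiebWeight f K ε) (x : Config N) : totalWeight f x ≤ N * K := by
  refine (Finset.sum_le_sum fun i _ => hw.le_bound (x i)).trans ?_
  simp

theorem norm_grad_totalWeight_le (hf : Differentiable ℝ f) (j : Fin N) (x : Config N) :
    ‖grad j (totalWeight f) x‖ ≤ ‖fderiv ℝ f (x j)‖ := by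
  have hd : HasFDerivAt (totalWeight f : Config N → ℝ)
      (∑ i, (fderiv ℝ f (x i)).comp (ContinuousLinearMap.proj i)) x :=
    HasFDerivAt.fun_sum fun i _ => (hf (x i)).hasFDerivAt.comp x
      (ContinuousLinearMap.proj (R := ℝ) (φ := fun _ : Fin N => Space) i).hasFDerivAt
  have hg : ∀ a, grad j (totalWeight f) x a = fderiv ℝ f (x j) (EuclideanSpace.single a 1) :=
    fun a => by
      simp only [grad, hd.fderiv, sum_apply, ContinuousLinearMap.comp_apply,
        ContinuousLinearMap.proj_apply]
      rw [Finset.sum_eq_single j]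
      · simp
      · intro i _ hi
        simp [hi]
      · simp
  set w := grad j (totalWeight f) x with hwdef
  have h1 : fderiv ℝ f (x j) w = ‖w‖ ^ 2 := by
    have hw : w = ∑ a, w a • (EuclideanSpace.single a 1 : Space) := by
      ext b
      simp [Pi.single_apply]
    conv_lhs => rw [hw]
    simp only [map_sum, map_smul, smul_eq_mul, EuclideanSpace.norm_sq_eq, ← hg, Real.norm_eq_abs,
      sq_abs]
    exact Finset.sum_congr rfl fun a _ => by ring
  by_contra! hlt
  have hpos : 0 < ‖w‖ := (norm_nonneg _).trans_lt hlt
  have h2 := (le_abs_self _).trans ((fderiv ℝ f (x j)).le_opNorm w)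
  rw [h1] at h2
  nlinarith

theorem norm_dirac_totalWeight_sq_le (hw : LiebWeight f K ε) (j : Fin N) {u : Config N → Spin N}
    (hu : Differentiable ℝ u) (x : Config N) :
    ‖dirac A j (fun y => totalWeight f y • u y) x‖ ^ 2
      ≤ 2 * (N * K) ^ 2 * ‖dirac A j u x‖ ^ 2 + 2 * ‖u x‖ ^ 2 := by
  have hF := (contDiff_totalWeight (N := N) hw.contDiff).differentiable (by simp) x
  have hfd : Differentiable ℝ f := hw.contDiff.differentiable (by simp)
  rw [dirac_mul j hF (hu x)]
  have h1 : ‖totalWeight f x • dirac A j u x‖ ≤ N * K * ‖dirac A j u x‖ := by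
    rw [norm_smul, Real.norm_of_nonneg (totalWeight_nonneg hw x)]
    gcongr
    exact totalWeight_le hw x
  have h2 : ‖(-Complex.I) • spinVec j (fun a => ((grad j (totalWeight f) x a : ℝ) : ℂ)) (u x)‖
      ≤ ‖u x‖ := by
    rw [norm_smul, norm_spinVec_ofReal]
    simp only [norm_neg, Complex.norm_I, one_mul]
    refine mul_le_of_le_one_left (norm_nonneg _) ?_
    exact (norm_grad_totalWeight_le hfd j x).trans (hw.norm_fderiv_le _)
  have h3 := (norm_add_le _ _).trans (add_le_add h1 h2)
  calc _ ≤ (N * K * ‖dirac A j u x‖ + ‖u x‖) ^ 2 := by gcongr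
    _ ≤ _ := by nlinarith [sq_nonneg (N * K * ‖dirac A j u x‖ - ‖u x‖)]

/-- Completing the square in `Re ⟨(σ · p) f u, (σ · p) u⟩` costs only `|∇f|² / (4 f) ≤ 1 / (4 |x|)`,
whatever the magnetic field. -/
theorem le_re_inner_dirac (hw : LiebWeight f K ε) (j : Fin N) {u : Config N → Spin N}
    (hu : Differentiable ℝ u) (x : Config N) :
    (totalWeight f x - f (x j)) * ‖dirac A j u x‖ ^ 2 - 1 / 4 * (1 / ‖x j‖) * ‖u x‖ ^ 2
      ≤ (⟪dirac A j (fun y => totalWeight f y • u y) x, dirac A j u x⟫_ℂ).re := by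
  have hF := (contDiff_totalWeight (N := N) hw.contDiff).differentiable (by simp) x
  have hfd : Differentiable ℝ f := hw.contDiff.differentiable (by simp)
  set D := dirac A j u x with hD
  set S := (-Complex.I) • spinVec j (fun a => ((grad j (totalWeight f) x a : ℝ) : ℂ)) (u x) with hS
  set G := ‖fderiv ℝ f (x j)‖ with hG
  have h1 : (⟪dirac A j (fun y => totalWeight f y • u y) x, D⟫_ℂ).re
      = totalWeight f x * ‖D‖ ^ 2 + (⟪S, D⟫_ℂ).re := by
    rw [dirac_mul j hF (hu x), inner_add_left, Complex.add_re, ← Complex.coe_smul, inner_smul_left,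
      Complex.conj_ofReal, Complex.re_ofReal_mul]
    congr 2
    exact inner_self_eq_norm_sq (𝕜 := ℂ) D
  have h2 : ‖S‖ ≤ G * ‖u x‖ := by
    rw [hS, norm_smul, norm_spinVec_ofReal]
    simp only [norm_neg, Complex.norm_I, one_mul]
    gcongr
    exact norm_grad_totalWeight_le hfd j x
  have h3 : -(G * ‖u x‖ * ‖D‖) ≤ (⟪S, D⟫_ℂ).re := by
    have h4 := (Complex.abs_re_le_norm ⟪S, D⟫_ℂ).trans (norm_inner_le_norm S D)
    have h5 : ‖S‖ * ‖D‖ ≤ G * ‖u x‖ * ‖D‖ := by gcongr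
    linarith [neg_abs_le (⟪S, D⟫_ℂ).re]
  have hq : 0 ≤ 1 / ‖x j‖ := by positivity
  have h6 : G ≤ √(f (x j)) * √(1 / ‖x j‖) := by
    rw [← Real.sqrt_mul (hw.nonneg _)]
    exact Real.le_sqrt_of_sq_le (hw.sq_norm_fderiv_le _)
  have h7 : G * ‖u x‖ * ‖D‖ ≤ √(f (x j)) * √(1 / ‖x j‖) * ‖u x‖ * ‖D‖ := by gcongr
  have h8 := sq_nonneg (√(f (x j)) * ‖D‖ - 1 / 2 * (√(1 / ‖x j‖) * ‖u x‖))
  have h9 := Real.sq_sqrt (hw.nonneg (x j))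
  have h10 := Real.sq_sqrt hq
  have h11 : (√(f (x j)) * ‖D‖ - 1 / 2 * (√(1 / ‖x j‖) * ‖u x‖)) ^ 2
      = √(f (x j)) ^ 2 * ‖D‖ ^ 2 - √(f (x j)) * √(1 / ‖x j‖) * ‖u x‖ * ‖D‖
        + 1 / 4 * √(1 / ‖x j‖) ^ 2 * ‖u x‖ ^ 2 := by ring
  rw [h9, h10] at h11
  rw [h1]
  linarith

end Kinetic

/-! ### Lieb's inequality on the core -/

section LiebInequality

variable {M : ℕ} {st : Statistics} {A : Space → Space} {f : Space → ℝ} {K ε : ℝ}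

/-- The weighted interaction `∑_{i ≠ j} f(x_i) / |x_i - x_j|`; the diagonal terms vanish. -/
def weightedRepulsion {N : ℕ} (f : Space → ℝ) (x : Config N) : ℝ :=
  ∑ i, f (x i) * ∑ j, 1 / ‖x i - x j‖

theorem integrable_comp_eval_mul {N : ℕ} (hw : LiebWeight f K ε) (i : Fin N) {h : Config N → ℝ}
    (hh : Integrable h) : Integrable fun x => f (x i) * h x :=
  hh.bdd_mul (c := K) (hw.contDiff.continuous.comp (continuous_apply i)).aestronglyMeasurable
    (Eventually.of_forall fun x => by
      rw [Real.norm_of_nonneg (hw.nonneg _)]; exact hw.le_bound _)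

theorem integrable_weightedRepulsion {N : ℕ} (hw : LiebWeight f K ε) {u : Config N → Spin N}
    (hu : u ∈ core st N) : Integrable fun x => weightedRepulsion f x * ‖u x‖ ^ 2 := by
  have h : ∀ i : Fin N, Integrable fun x => f (x i) * ((∑ j, 1 / ‖x i - x j‖) * ‖u x‖ ^ 2) :=
    fun i => integrable_comp_eval_mul hw i (integrable_mul_norm_sq
      (locallyIntegrable_finsetSum _ fun j _ => locallyIntegrable_inv_norm_sub i j) hu)
  refine (integrable_finsetSum Finset.univ fun i _ => h i).congr (Eventually.of_forall fun x => ?_)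
  simp only [weightedRepulsion]
  rw [Finset.sum_mul]
  exact Finset.sum_congr rfl fun i _ => by ring

/-- The pointwise content of Lieb's argument. -/
theorem pointwise_lieb {Z : ℝ} (hZ : 0 ≤ Z) (hw : LiebWeight f K ε)
    {u : Config (M + 1) → Spin (M + 1)} (hu : Differentiable ℝ u) (x : Config (M + 1)) :
    (∑ i : Fin (M + 1), (∑ k : Fin M, f (x i) * ‖dirac A (i.succAbove k) u x‖ ^ 2
        + f (x i) * (coulomb Z (x ∘ i.succAbove) * ‖u x‖ ^ 2)))
      + weightedRepulsion f x * ‖u x‖ ^ 2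
      ≤ (∑ j, (⟪dirac A j (fun y => totalWeight f y • u y) x, dirac A j u x⟫_ℂ).re)
        + coulomb Z x * (totalWeight f x * ‖u x‖ ^ 2)
        + (1 / 4 + Z * ε) * (attraction x * ‖u x‖ ^ 2) + Z * (M + 1) * ‖u x‖ ^ 2 := by
  have hkin := Finset.sum_le_sum fun j (_ : j ∈ Finset.univ) =>
    le_re_inner_dirac (A := A) hw j hu x
  have hcomb : ∑ j, (totalWeight f x - f (x j)) * ‖dirac A j u x‖ ^ 2
      = ∑ i : Fin (M + 1), ∑ k : Fin M, f (x i) * ‖dirac A (i.succAbove k) u x‖ ^ 2 := by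
    have h : ∀ i : Fin (M + 1), ∑ k : Fin M, f (x i) * ‖dirac A (i.succAbove k) u x‖ ^ 2
        = f (x i) * ∑ k, ‖dirac A k u x‖ ^ 2 - f (x i) * ‖dirac A i u x‖ ^ 2 := fun i => by
      rw [Fin.sum_univ_succAbove (fun k => ‖dirac A k u x‖ ^ 2) i, ← Finset.mul_sum]
      ring
    rw [Finset.sum_congr rfl fun i _ => h i, Finset.sum_sub_distrib, ← Finset.sum_mul,
      Finset.mul_sum, ← Finset.sum_sub_distrib]
    exact Finset.sum_congr rfl fun j _ => by rw [totalWeight]; ring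
  have hcoul : coulomb Z x * (totalWeight f x * ‖u x‖ ^ 2)
      = (∑ i : Fin (M + 1), f (x i) * (coulomb Z (x ∘ i.succAbove) * ‖u x‖ ^ 2))
        - Z * (∑ i, f (x i) * (1 / ‖x i‖)) * ‖u x‖ ^ 2 + weightedRepulsion f x * ‖u x‖ ^ 2 := by
    have h1 : ∀ i : Fin (M + 1), coulomb Z x
        = coulomb Z (x ∘ i.succAbove) - Z * (1 / ‖x i‖) + ∑ j, 1 / ‖x i - x j‖ := fun i => by
      rw [coulomb_eq, coulomb_eq, attraction_succAbove i x, repulsion_succAbove i x]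
      ring
    rw [totalWeight, weightedRepulsion, Finset.sum_mul, Finset.mul_sum, Finset.mul_sum,
      Finset.sum_mul, Finset.sum_mul, ← Finset.sum_sub_distrib, ← Finset.sum_add_distrib]
    refine Finset.sum_congr rfl fun i _ => ?_
    rw [h1 i]
    ring
  have hatt : ∑ i, f (x i) * (1 / ‖x i‖) ≤ (M + 1) + ε * attraction x := by
    have h1 : ∀ i, f (x i) * (1 / ‖x i‖) ≤ 1 + ε * (1 / ‖x i‖) := fun i => by
      rcases eq_or_ne (x i) 0 with h0 | h0
      · simp [h0]
      · have hp : 0 < ‖x i‖ := norm_pos_iff.2 h0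
        calc f (x i) * (1 / ‖x i‖) ≤ (‖x i‖ + ε) * (1 / ‖x i‖) := by
              gcongr
              exact hw.le_add _
          _ = 1 + ε * (1 / ‖x i‖) := by field_simp
    refine (Finset.sum_le_sum fun i _ => h1 i).trans_eq ?_
    rw [Finset.sum_add_distrib, ← Finset.mul_sum, attraction]
    simp
  have hatt' : Z * (∑ i, f (x i) * (1 / ‖x i‖)) * ‖u x‖ ^ 2
      ≤ Z * ((M + 1) + ε * attraction x) * ‖u x‖ ^ 2 := by gcongr
  have h4 : ∑ j, 1 / 4 * (1 / ‖x j‖) * ‖u x‖ ^ 2 = 1 / 4 * (attraction x * ‖u x‖ ^ 2) := by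
    rw [← Finset.sum_mul, ← Finset.mul_sum, attraction]
    ring
  rw [Finset.sum_sub_distrib, hcomb, h4] at hkin
  rw [hcoul, Finset.sum_add_distrib]
  linarith

theorem re_form_totalWeight (hA : LocallySquareIntegrable A) (Z : ℝ) (hw : LiebWeight f K ε)
    {N : ℕ} {u : Config N → Spin N} (hu : u ∈ core st N) :
    (form A Z (fun y => totalWeight f y • u y) u).re
      = (∫ x, ∑ j, (⟪dirac A j (fun y => totalWeight f y • u y) x, dirac A j u x⟫_ℂ).re)
        + ∫ x, coulomb Z x * (totalWeight f x * ‖u x‖ ^ 2) := by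
  have hFu := smul_mem_core (contDiff_totalWeight hw.contDiff) totalWeight_comp_perm hu
  have hre : ∀ j, Integrable fun x =>
      (⟪dirac A j (fun y => totalWeight f y • u y) x, dirac A j u x⟫_ℂ).re := fun j =>
    (integrable_inner_dirac hA j hFu hu).re
  rw [form, Complex.add_re, Complex.re_sum, integral_finsetSum _ fun j _ => hre j]
  congr 1
  · refine Finset.sum_congr rfl fun j _ => ?_
    exact (integral_re (𝕜 := ℂ) (integrable_inner_dirac hA j hFu hu)).symm
  · rw [← Complex.ofReal_re (∫ x, coulomb Z x * (totalWeight f x * ‖u x‖ ^ 2)),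
      ← integral_complex_ofReal]
    congr 1
    refine integral_congr_ae (Eventually.of_forall fun x => ?_)
    simp only
    rw [← Complex.coe_smul, inner_smul_left, inner_self_eq_norm_sq_to_K, Complex.conj_ofReal]
    push_cast
    rfl

/-- Lieb's inequality: testing with `∑_i f(x_i) u` bounds the weighted repulsion. -/
theorem integral_weightedRepulsion_le (hA : LocallySquareIntegrable A) {c Z : ℝ} (hZ : 0 ≤ Z)
    (hw : LiebWeight f K ε) (hc : ∀ v ∈ core st M, c * ∫ x, ‖v x‖ ^ 2 ≤ (form A Z v v).re)
    {u : Config (M + 1) → Spin (M + 1)} (hu : u ∈ core st (M + 1)) :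
    ∫ x, weightedRepulsion f x * ‖u x‖ ^ 2
      ≤ (form A Z (fun y => totalWeight f y • u y) u).re
        - c * (∫ x, totalWeight f x * ‖u x‖ ^ 2)
        + (1 / 4 + Z * ε) * (∫ x, attraction x * ‖u x‖ ^ 2) + Z * (M + 1) * ∫ x, ‖u x‖ ^ 2 := by
  have hFu := smul_mem_core (contDiff_totalWeight hw.contDiff) totalWeight_comp_perm hu
  have hI1 : ∀ i k, Integrable fun x => f (x i) * ‖dirac A k u x‖ ^ 2 := fun i k =>
    integrable_comp_eval_mul hw i (integrable_norm_sq_dirac hA k hu)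
  have hI2 : ∀ i : Fin (M + 1), Integrable fun x =>
      f (x i) * (coulomb Z (x ∘ i.succAbove) * ‖u x‖ ^ 2) := fun i =>
    integrable_comp_eval_mul hw i
      (integrable_mul_norm_sq (locallyIntegrable_coulomb_comp i.succAbove Z) hu)
  have hI1s : ∀ i : Fin (M + 1), Integrable fun x =>
      ∑ k : Fin M, f (x i) * ‖dirac A (i.succAbove k) u x‖ ^ 2 := fun i =>
    integrable_finsetSum _ fun k _ => hI1 i _
  have hI3 : ∀ i : Fin (M + 1), Integrable fun x =>
      ∑ k : Fin M, f (x i) * ‖dirac A (i.succAbove k) u x‖ ^ 2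
        + f (x i) * (coulomb Z (x ∘ i.succAbove) * ‖u x‖ ^ 2) := fun i =>
    (hI1s i).add (hI2 i)
  have hL1 : Integrable fun x => ∑ i : Fin (M + 1),
      (∑ k : Fin M, f (x i) * ‖dirac A (i.succAbove k) u x‖ ^ 2
        + f (x i) * (coulomb Z (x ∘ i.succAbove) * ‖u x‖ ^ 2)) :=
    integrable_finsetSum _ fun i _ => hI3 i
  have hL2 := integrable_weightedRepulsion hw hu
  have hR1 : Integrable fun x =>
      ∑ j, (⟪dirac A j (fun y => totalWeight f y • u y) x, dirac A j u x⟫_ℂ).re :=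
    integrable_finsetSum _ fun j _ => (integrable_inner_dirac hA j hFu hu).re
  have hR2 : Integrable fun x => coulomb Z x * (totalWeight f x * ‖u x‖ ^ 2) := by
    refine integrable_mul_of_hasCompactSupport (locallyIntegrable_coulomb Z)
      ((contDiff_totalWeight hw.contDiff).continuous.mul (hu.1.continuous.norm.pow 2)) ?_
    exact (hu.2.1.norm.comp_left (g := fun t : ℝ => t ^ 2) (by simp)).mul_left
  have hR3 := (integrable_mul_norm_sq locallyIntegrable_attraction hu).const_mul (1 / 4 + Z * ε)
  have hR4 := (integrable_norm_sq hu).const_mul (Z * (M + 1))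
  have hR12 : Integrable fun x =>
      (∑ j, (⟪dirac A j (fun y => totalWeight f y • u y) x, dirac A j u x⟫_ℂ).re)
        + coulomb Z x * (totalWeight f x * ‖u x‖ ^ 2) := hR1.add hR2
  have hR123 : Integrable fun x =>
      (∑ j, (⟪dirac A j (fun y => totalWeight f y • u y) x, dirac A j u x⟫_ℂ).re)
        + coulomb Z x * (totalWeight f x * ‖u x‖ ^ 2)
        + (1 / 4 + Z * ε) * (attraction x * ‖u x‖ ^ 2) := hR12.add hR3
  have hint := integral_mono (hL1.add hL2) (hR123.add hR4) fun x =>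
    pointwise_lieb (A := A) hZ hw (differentiable_of_mem_core hu) x
  rw [integral_add' hL1 hL2, integral_add' hR123 hR4, integral_add hR12 hR3, integral_add hR1 hR2,
    integral_const_mul, integral_const_mul, ← re_form_totalWeight hA Z hw hu,
    integral_finsetSum _ fun i _ => hI3 i] at hint
  have hslice : ∀ i : Fin (M + 1), c * ∫ x, f (x i) * ‖u x‖ ^ 2
      ≤ ∫ x, (∑ k : Fin M, f (x i) * ‖dirac A (i.succAbove k) u x‖ ^ 2
        + f (x i) * (coulomb Z (x ∘ i.succAbove) * ‖u x‖ ^ 2)) := fun i => by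
    rw [integral_add (hI1s i) (hI2 i), integral_finsetSum _ fun k _ => hI1 i _]
    exact weighted_form_le hA hc hw.contDiff.continuous hw.nonneg hw.le_bound hu i
  have hsum := Finset.sum_le_sum fun i (_ : i ∈ Finset.univ) => hslice i
  rw [← Finset.mul_sum, ← integral_finsetSum _ fun i _ =>
    integrable_comp_eval_mul hw i (integrable_norm_sq hu)] at hsum
  have hF : ∫ x, totalWeight f x * ‖u x‖ ^ 2 = ∫ x, ∑ i, f (x i) * ‖u x‖ ^ 2 := by
    simp only [totalWeight, Finset.sum_mul]
  rw [hF]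
  linarith

end LiebInequality

/-! ### Passage to the eigenvector -/

section Approximation

variable {N : ℕ} {st : Statistics} {A : Space → Space} {f : Space → ℝ} {K ε : ℝ}

/-- Raising the nuclear charge from `Z` to `k Z` controls the nuclear attraction. -/
theorem integral_attraction_le (hA : LocallySquareIntegrable A) {Z k : ℝ}
    (hb : BoundedBelow st A N (k * Z)) {u : Config N → Spin N} (hu : u ∈ core st N) :
    (k - 1) * Z * ∫ x, attraction x * ‖u x‖ ^ 2
      ≤ (form A Z u u).re - energy st A N (k * Z) * ∫ x, ‖u x‖ ^ 2 := by
  have h := energy_mul_le hA hb hu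
  rw [re_form_eq _ hu] at h ⊢
  linarith

/-- Stability at charge `2 Z` bounds the kinetic and repulsive energies by the form at charge
`Z`. -/
theorem kinetic_add_repulsion_le {c Z : ℝ}
    (hc : ∀ v ∈ core st N, c * ∫ x, ‖v x‖ ^ 2 ≤ (form A (2 * Z) v v).re)
    {u : Config N → Spin N} (hu : u ∈ core st N) :
    ∑ j, (∫ x, ‖dirac A j u x‖ ^ 2) + ∫ x, repulsion x * ‖u x‖ ^ 2
      ≤ 2 * (form A Z u u).re - c * ∫ x, ‖u x‖ ^ 2 := by
  have h := hc u hu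
  rw [re_form_eq _ hu] at h ⊢
  linarith

theorem norm_sq_totalWeight_smul_le (hw : LiebWeight f K ε) (u : Config N → Spin N)
    (x : Config N) : ‖totalWeight f x • u x‖ ^ 2 ≤ (N * K) ^ 2 * ‖u x‖ ^ 2 := by
  have h0 := totalWeight_nonneg hw x
  rw [norm_smul, mul_pow, Real.norm_of_nonneg h0]
  gcongr
  exact totalWeight_le hw x

/-- Multiplication by a Lieb weight is bounded in the form norm; only the repulsive part of the
potential is kept. -/
theorem re_form_totalWeight_self_le (hA : LocallySquareIntegrable A) {Z : ℝ} (hZ : 0 ≤ Z)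
    (hw : LiebWeight f K ε) {u : Config N → Spin N} (hu : u ∈ core st N) :
    (form A Z (fun y => totalWeight f y • u y) (fun y => totalWeight f y • u y)).re
      ≤ 2 * (N * K) ^ 2 * (∑ j, (∫ x, ‖dirac A j u x‖ ^ 2) + ∫ x, repulsion x * ‖u x‖ ^ 2)
        + 2 * N * ∫ x, ‖u x‖ ^ 2 := by
  have hFu := smul_mem_core (contDiff_totalWeight hw.contDiff) totalWeight_comp_perm hu
  have h1 : ∀ j, ∫ x, ‖dirac A j (fun y => totalWeight f y • u y) x‖ ^ 2
      ≤ 2 * (N * K) ^ 2 * (∫ x, ‖dirac A j u x‖ ^ 2) + 2 * ∫ x, ‖u x‖ ^ 2 := fun j => by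
    have hD := (integrable_norm_sq_dirac hA j hu).const_mul (2 * (N * K) ^ 2)
    have hU := (integrable_norm_sq hu).const_mul 2
    rw [← integral_const_mul, ← integral_const_mul, ← integral_add hD hU]
    exact integral_mono (integrable_norm_sq_dirac hA j hFu) (hD.add hU) fun x =>
      norm_dirac_totalWeight_sq_le hw j (differentiable_of_mem_core hu) x
  have h2 : ∫ x, repulsion x * ‖totalWeight f x • u x‖ ^ 2
      ≤ (N * K) ^ 2 * ∫ x, repulsion x * ‖u x‖ ^ 2 := by
    have hR := integrable_mul_norm_sq locallyIntegrable_repulsion hu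
    rw [← integral_const_mul]
    refine integral_mono (integrable_mul_norm_sq locallyIntegrable_repulsion hFu)
      (hR.const_mul _) fun x => ?_
    have := mul_le_mul_of_nonneg_left (norm_sq_totalWeight_smul_le hw u x) (repulsion_nonneg x)
    simp only
    linarith
  have h3 : 0 ≤ Z * ∫ x, attraction x * ‖totalWeight f x • u x‖ ^ 2 :=
    mul_nonneg hZ (integral_nonneg fun x => mul_nonneg (attraction_nonneg x) (sq_nonneg _))
  have h4 : 0 ≤ (N * K) ^ 2 * ∫ x, repulsion x * ‖u x‖ ^ 2 :=
    mul_nonneg (sq_nonneg _)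
      (integral_nonneg fun x => mul_nonneg (repulsion_nonneg x) (sq_nonneg _))
  have h5 := Finset.sum_le_sum fun j (_ : j ∈ Finset.univ) => h1 j
  rw [Finset.sum_add_distrib, ← Finset.mul_sum, Finset.sum_const, Finset.card_univ,
    Fintype.card_fin, nsmul_eq_mul] at h5
  rw [re_form_eq _ hFu]
  linarith

/-- Along a sequence that realises an eigenvector, testing with `∑_i f(x_i) u` asymptotically
returns the eigenvalue. -/
theorem tendsto_re_form_totalWeight_sub (hA : LocallySquareIntegrable A) {Z : ℝ} (hZ : 0 ≤ Z)
    (hb : BoundedBelow st A N Z) (hb2 : BoundedBelow st A N (2 * Z)) (hw : LiebWeight f K ε)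
    {u : ℕ → coreSubmodule st N} {ψ : hilbert st N} {E : ℝ}
    (hψ : Tendsto (fun n => toHilbert st N (u n)) atTop (𝓝 ψ))
    (hc : Tendsto (fun m : ℕ × ℕ => formL hA st N Z (u m.1 - u m.2) (u m.1 - u m.2)) atTop (𝓝 0))
    (hη : ∀ φ, Tendsto (fun n => formL hA st N Z φ (u n)) atTop
      (𝓝 ⟪toHilbert st N φ, (E : ℂ) • ψ⟫_ℂ)) :
    Tendsto (fun n => (form A Z (fun y => totalWeight f y • (u n : Config N → Spin N) y) (u n)).re
      - E * ∫ x, totalWeight f x * ‖(u n : Config N → Spin N) x‖ ^ 2) atTop (𝓝 0) := by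
  obtain ⟨c, hlow⟩ := hb
  obtain ⟨c2, hlow2⟩ := hb2
  have hlow' : ∀ x : coreSubmodule st N, c * ‖toHilbert st N x‖ ^ 2 ≤ (formL hA st N Z x x).re :=
    fun x => by rw [norm_sq_toHilbert]; exact hlow x x.2
  let v : ℕ → coreSubmodule st N := fun n =>
    ⟨fun y => totalWeight f y • (u n : Config N → Spin N) y, smul_mem_core (contDiff_totalWeight hw.contDiff)
      totalWeight_comp_perm (u n).2⟩
  obtain ⟨B, hB⟩ := exists_form_le_of_tendsto (conj_formL hA Z) hlow' hψ hc
  have hB0 : 0 ≤ B := (sq_nonneg _).trans (hB 0).2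
  set Q := (2 * (N * K) ^ 2) * (2 * B + |c2| * B) + 2 * N * B + (N * K) ^ 2 * B with hQ
  have hJv : ∀ n, ‖toHilbert st N (v n)‖ ^ 2 ≤ (N * K) ^ 2 * B := fun n => by
    rw [norm_sq_toHilbert]
    have h1 : ∫ x, ‖(v n : Config N → Spin N) x‖ ^ 2
        ≤ (N * K) ^ 2 * ∫ x, ‖(u n : Config N → Spin N) x‖ ^ 2 := by
      rw [← integral_const_mul]
      exact integral_mono (integrable_norm_sq (v n).2) ((integrable_norm_sq (u n).2).const_mul _)
        fun x => norm_sq_totalWeight_smul_le hw _ x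
    have h2 := (hB n).2
    rw [norm_sq_toHilbert] at h2
    refine h1.trans ?_
    gcongr
  have hQ1 : (N * K) ^ 2 * B ≤ Q := by
    have : 0 ≤ (2 * (N * K) ^ 2) * (2 * B + |c2| * B) + 2 * N * B := by positivity
    linarith
  have hbv : ∀ n, (formL hA st N Z (v n) (v n)).re ≤ Q := fun n => by
    have h1 := re_form_totalWeight_self_le hA hZ hw (u n).2
    have h2 := kinetic_add_repulsion_le hlow2 (u n).2
    have h3 := hB n
    rw [norm_sq_toHilbert, formL_apply] at h3
    set I := ∫ x, ‖(u n : Config N → Spin N) x‖ ^ 2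
    have hI : 0 ≤ I := integral_nonneg fun x => sq_nonneg _
    have h4 : -(c2 * I) ≤ |c2| * B := by
      calc -(c2 * I) = -c2 * I := by ring
        _ ≤ |c2| * I := by gcongr; exact neg_le_abs c2
        _ ≤ |c2| * B := by gcongr; exact h3.2
    have h5 := h2.trans (show _ ≤ 2 * B + |c2| * B by linarith [h3.1])
    refine h1.trans ?_
    have h6 : 2 * (N * K) ^ 2 * (∑ j, (∫ x, ‖dirac A j (u n : Config N → Spin N) x‖ ^ 2)
        + ∫ x, repulsion x * ‖(u n : Config N → Spin N) x‖ ^ 2)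
        ≤ 2 * (N * K) ^ 2 * (2 * B + |c2| * B) := by gcongr
    have h7 : 2 * N * I ≤ 2 * N * B := by
      have := h3.2
      gcongr
    have h8 : 0 ≤ (N * K) ^ 2 * B := by positivity
    linarith
  have h1 := tendsto_form_sub_inner (conj_formL hA Z) hlow' hψ hc hη hbv
    fun n => (hJv n).trans hQ1
  have h2 : Tendsto (fun n => (E : ℂ) * ⟪toHilbert st N (v n), ψ - toHilbert st N (u n)⟫_ℂ) atTop
      (𝓝 0) := by
    have h3 : Tendsto (fun n => |E| * (√Q * ‖ψ - toHilbert st N (u n)‖)) atTop (𝓝 0) := by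
      have : Tendsto (fun n => ψ - toHilbert st N (u n)) atTop (𝓝 0) := by
        simpa using hψ.const_sub ψ
      simpa using (this.norm.const_mul √Q).const_mul |E|
    refine squeeze_zero_norm (fun n => ?_) h3
    rw [norm_mul, Complex.norm_real, Real.norm_eq_abs]
    gcongr
    refine (norm_inner_le_norm (𝕜 := ℂ) (E := hilbert st N) _ _).trans ?_
    gcongr
    exact Real.le_sqrt_of_sq_le ((hJv n).trans hQ1)
  have h3 := (Complex.continuous_re.tendsto _).comp (h1.add h2)
  simp only [add_zero, Complex.zero_re] at h3
  refine h3.congr fun n => ?_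
  have h4 : ⟪toHilbert st N (v n), toHilbert st N (u n)⟫_ℂ
      = ((∫ x, totalWeight f x * ‖(u n : Config N → Spin N) x‖ ^ 2 : ℝ) : ℂ) := by
    rw [inner_toHilbert]
    refine Eq.trans ?_ integral_complex_ofReal
    refine integral_congr_ae ?_
    filter_upwards [toHilbert_ae (u n)] with x hx
    rw [hx]
    simp only [v]
    rw [← Complex.coe_smul, inner_smul_left, inner_self_eq_norm_sq_to_K, Complex.conj_ofReal]
    push_cast
    rfl
  have h6 : ⟪toHilbert st N (v n), (E : ℂ) • ψ⟫_ℂ = E * ⟪toHilbert st N (v n), ψ⟫_ℂ :=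
    inner_smul_right (𝕜 := ℂ) (E := hilbert st N) _ _ _
  rw [Function.comp_apply, inner_sub_right, h4, h6]
  have h5 : ∀ a b : ℂ, ∀ r : ℝ, (a - E * b + E * (b - (r : ℂ))).re = a.re - E * r := fun a b r => by
    have : a - E * b + E * (b - (r : ℂ)) = a - ((E * r : ℝ) : ℂ) := by push_cast; ring
    rw [this, Complex.sub_re, Complex.ofReal_re]
  rw [h5]
  rfl

/-- Fatou's lemma along a sequence in the core that converges in the Hilbert space. -/
theorem lintegral_mul_norm_sq_le_of_tendsto {V : Config N → ℝ} {u : ℕ → coreSubmodule st N}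
    {ψ : hilbert st N} (hψ : Tendsto (fun n => toHilbert st N (u n)) atTop (𝓝 ψ))
    (hV : ∀ x, 0 ≤ V x)
    (hI : ∀ n, Integrable fun x => V x * ‖(u n : Config N → Spin N) x‖ ^ 2) {a : ℕ → ℝ} {L : ℝ}
    (ha : ∀ n, ∫ x, V x * ‖(u n : Config N → Spin N) x‖ ^ 2 ≤ a n)
    (hL : Tendsto a atTop (𝓝 L)) :
    ∫⁻ x, ENNReal.ofReal (V x * ‖(ψ : L2 N) x‖ ^ 2) ≤ ENNReal.ofReal L := by
  have hψ' : Tendsto (fun n => (toHilbert st N (u n) : L2 N)) atTop (𝓝 (ψ : L2 N)) :=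
    (continuous_subtype_val.tendsto _).comp hψ
  obtain ⟨ns, hmono, hns⟩ := (tendstoInMeasure_of_tendsto_Lp hψ').exists_seq_tendsto_ae
  have hae : ∀ᵐ x, ∀ n, (toHilbert st N (u n) : L2 N) x = (u n : Config N → Spin N) x :=
    ae_all_iff.2 fun n => toHilbert_ae (u n)
  have hlim : ∀ᵐ x, ENNReal.ofReal (V x * ‖(ψ : L2 N) x‖ ^ 2)
      = liminf (fun i => ENNReal.ofReal (V x * ‖(u (ns i) : Config N → Spin N) x‖ ^ 2)) atTop := by
    filter_upwards [hns, hae] with x h1 h2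
    simp only [h2] at h1
    exact (ENNReal.tendsto_ofReal ((h1.norm.pow 2).const_mul (V x))).liminf_eq.symm
  rw [lintegral_congr_ae hlim]
  refine (lintegral_liminf_le' fun i => (hI (ns i)).aemeasurable.ennreal_ofReal).trans ?_
  have h3 : Tendsto (fun i => ENNReal.ofReal (a (ns i))) atTop (𝓝 (ENNReal.ofReal L)) :=
    ENNReal.tendsto_ofReal (hL.comp hmono.tendsto_atTop)
  rw [← h3.liminf_eq]
  refine liminf_le_liminf (Eventually.of_forall fun i => ?_)
  rw [← ofReal_integral_eq_lintegral_ofReal (hI (ns i))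
    (Eventually.of_forall fun x => mul_nonneg (hV x) (sq_nonneg _))]
  exact ENNReal.ofReal_le_ofReal (ha (ns i))

end Approximation

/-! ### Strict triangle inequality -/

section Strictness

variable {N : ℕ}

/-- Almost every pair of positions is distinct and satisfies the strict triangle inequality. -/
theorem ae_norm_sub_lt {i j : Fin N} (hij : i ≠ j) :
    ∀ᵐ x : Config N, x i ≠ x j ∧ ‖x i - x j‖ < ‖x i‖ + ‖x j‖ := by
  -- It suffices to look at the pair alone; for fixed `x i = a ≠ 0` the bad `x j` lie on a line.
  let L : Config N →ₗ[ℝ] Space × Space := (LinearMap.proj i).prod (LinearMap.proj j)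
  have hL : Function.Surjective L := fun p => by
    refine ⟨Function.update (fun _ => p.1) j p.2, Prod.ext ?_ ?_⟩
    · simp [L, hij]
    · simp [L]
  let s : Set (Space × Space) := {p | p.1 ≠ p.2 ∧ ‖p.1 - p.2‖ < ‖p.1‖ + ‖p.2‖}
  have hs : MeasurableSet s := by
    refine IsOpen.measurableSet (IsOpen.and ?_ ?_)
    · exact isOpen_ne_fun continuous_fst continuous_snd
    · exact isOpen_lt (continuous_fst.sub continuous_snd).norm
        (continuous_fst.norm.add continuous_snd.norm)
  refine (ae_comp_linearMap_mem_iff L volume ((volume : Measure Space).prod volume) hL hs).2 ?_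
  rw [Measure.ae_prod_mem_iff_ae_ae_mem hs]
  have h0 : ∀ᵐ a : Space, a ≠ 0 := by simp [ae_iff]
  filter_upwards [h0] with a ha
  have hspan : volume ((Submodule.span ℝ {a} : Submodule ℝ Space) : Set Space) = 0 := by
    refine Measure.addHaar_submodule _ _ fun htop => ?_
    have h1 := finrank_span_singleton (K := ℝ) ha
    rw [htop, finrank_top] at h1
    simp at h1
  have h2 : ∀ᵐ b : Space, b ∉ (Submodule.span ℝ {a} : Submodule ℝ Space) :=
    measure_eq_zero_iff_ae_notMem.1 hspan
  filter_upwards [h2] with b hb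
  refine ⟨fun h => hb ?_, lt_of_le_of_ne (norm_sub_le _ _) fun h => hb ?_⟩
  · have hab : a = b := h
    rw [← hab]
    exact Submodule.mem_span_singleton_self a
  · have h3 : SameRay ℝ a (-b) := by
      rw [sameRay_iff_norm_add, ← sub_eq_add_neg, norm_neg]
      exact h
    obtain ⟨r, -, hr⟩ := h3.exists_nonneg_left ha
    exact Submodule.mem_span_singleton.2 ⟨-r, by rw [neg_smul, hr, neg_neg]⟩

/-- For the weight `|x|` the weighted repulsion exceeds the number of pairs, by the triangle
inequality. -/
theorem ae_lt_weightedRepulsion {M : ℕ} (hM : 1 ≤ M) :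
    ∀ᵐ x : Config (M + 1), ((M : ℝ) + 1) * M / 2 < weightedRepulsion (fun y => ‖y‖) x := by
  have hall : ∀ᵐ x : Config (M + 1), ∀ i j, i ≠ j →
      (x i ≠ x j ∧ ‖x i - x j‖ < ‖x i‖ + ‖x j‖) := by
    refine ae_all_iff.2 fun i => ae_all_iff.2 fun j => ?_
    by_cases hij : i = j
    · exact Eventually.of_forall fun x h => (h hij).elim
    · filter_upwards [ae_norm_sub_lt hij] with x hx _ using hx
  filter_upwards [hall] with x hx
  have h1 : 2 * weightedRepulsion (fun y => ‖y‖) x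
      = ∑ i, ∑ j, (‖x i‖ + ‖x j‖) * (1 / ‖x i - x j‖) := by
    have h2 : ∑ i, ∑ j, ‖x j‖ * (1 / ‖x i - x j‖) = weightedRepulsion (fun y => ‖y‖) x := by
      rw [Finset.sum_comm, weightedRepulsion]
      refine Finset.sum_congr rfl fun i _ => ?_
      rw [Finset.mul_sum]
      exact Finset.sum_congr rfl fun j _ => by rw [norm_sub_rev]
    simp only [add_mul, Finset.sum_add_distrib]
    rw [h2, two_mul]
    simp only [weightedRepulsion, Finset.mul_sum]
  have hlt : ∀ i j, i ≠ j → 1 < (‖x i‖ + ‖x j‖) * (1 / ‖x i - x j‖) := fun i j hij => by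
    obtain ⟨h3, h4⟩ := hx i j hij
    rw [mul_one_div, one_lt_div (norm_pos_iff.2 (sub_ne_zero.2 h3))]
    exact h4
  have hle : ∀ i j, (if i = j then (0 : ℝ) else 1) ≤ (‖x i‖ + ‖x j‖) * (1 / ‖x i - x j‖) :=
    fun i j => by
      split_ifs with hij
      · positivity
      · exact (hlt i j hij).le
  have hne : (0 : Fin (M + 1)) ≠ Fin.last M := by
    intro h
    have := congrArg Fin.val h
    simp at this
    omega
  have h2 : ∑ i : Fin (M + 1), ∑ j : Fin (M + 1), (if i = j then (0 : ℝ) else 1)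
      < ∑ i, ∑ j, (‖x i‖ + ‖x j‖) * (1 / ‖x i - x j‖) := by
    refine Finset.sum_lt_sum (fun i _ => Finset.sum_le_sum fun j _ => hle i j)
      ⟨0, Finset.mem_univ _, Finset.sum_lt_sum (fun j _ => hle 0 j)
        ⟨Fin.last M, Finset.mem_univ _, ?_⟩⟩
    rw [if_neg hne]
    exact hlt _ _ hne
  have h3 : ∀ i : Fin (M + 1), ∑ j : Fin (M + 1), (if i = j then (0 : ℝ) else 1) = M := fun i => by
    rw [Fin.sum_univ_succAbove _ i]
    simp
  rw [← h1, Finset.sum_congr rfl fun i _ => h3 i, Finset.sum_const, Finset.card_univ,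
    Fintype.card_fin, nsmul_eq_mul] at h2
  push_cast at h2
  linarith

/-- A bound on the expectation of `V` in a nonzero state exceeds any number that `V` exceeds
almost everywhere. -/
theorem lt_of_lintegral_le {V : Config N → ℝ} (hVm : Measurable V) {κ D : ℝ} (hκ : 0 ≤ κ)
    (hV : ∀ᵐ x, κ < V x) {ψ : L2 N} (hψ : ψ ≠ 0)
    (h : ∫⁻ x, ENNReal.ofReal (V x * ‖ψ x‖ ^ 2) ≤ ENNReal.ofReal (D * ‖ψ‖ ^ 2)) : κ < D := by
  by_contra! hD
  have hint : Integrable fun x => ‖ψ x‖ ^ 2 := (Lp.memLp ψ).integrable_norm_pow two_ne_zero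
  have h1 : ∫⁻ x, ENNReal.ofReal (κ * ‖ψ x‖ ^ 2) = ENNReal.ofReal (κ * ‖ψ‖ ^ 2) := by
    rw [← ofReal_integral_eq_lintegral_ofReal (hint.const_mul κ)
      (Eventually.of_forall fun x => by positivity), integral_const_mul, norm_sq_eq_integral]
  have h2 : (fun x => ENNReal.ofReal (κ * ‖ψ x‖ ^ 2))
      ≤ᵐ[volume] fun x => ENNReal.ofReal (V x * ‖ψ x‖ ^ 2) := by
    filter_upwards [hV] with x hx
    gcongr
  have hm : AEMeasurable fun x => ENNReal.ofReal (V x * ‖ψ x‖ ^ 2) :=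
    (hVm.aemeasurable.mul hint.aemeasurable).ennreal_ofReal
  have h3 := ae_eq_of_ae_le_of_lintegral_le h2 (by rw [h1]; exact ENNReal.ofReal_ne_top) hm
    (h.trans (by rw [h1]; gcongr))
  refine hψ ((Lp.eq_zero_iff_ae_eq_zero).2 ?_)
  filter_upwards [h3, hV] with x hx hκV
  have hV0 : 0 ≤ V x := hκ.trans hκV.le
  rw [ENNReal.ofReal_eq_ofReal_iff (by positivity) (by positivity)] at hx
  have h4 : (V x - κ) * ‖ψ x‖ ^ 2 = 0 := by linarith
  rcases mul_eq_zero.1 h4 with h5 | h5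
  · linarith
  · simpa using h5

end Strictness

/-! ### The bound on the particle number -/

section Bound

variable {st : Statistics} {A : Space → Space}

theorem measurable_weightedRepulsion {N : ℕ} {f : Space → ℝ} (hf : Continuous f) :
    Measurable (weightedRepulsion f : Config N → ℝ) := by
  unfold weightedRepulsion
  refine Finset.measurable_sum _ fun i _ => ?_
  refine (hf.comp (continuous_apply i)).measurable.mul (Finset.measurable_sum _ fun j _ => ?_)
  exact measurable_const.div ((measurable_pi_apply i).sub (measurable_pi_apply j)).norm

theorem weightedRepulsion_nonneg {N : ℕ} {f : Space → ℝ} (hf : ∀ y, 0 ≤ f y) (x : Config N) :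
    0 ≤ weightedRepulsion f x :=
  Finset.sum_nonneg fun i _ =>
    mul_nonneg (hf _) (Finset.sum_nonneg fun _ _ => by positivity)

/-- The bound on the particle number whenever the ground state energy is an eigenvalue. -/
theorem lt_of_mem_boundNumbers (hA : LocallySquareIntegrable A)
    (hfin : ∀ (N : ℕ) (Z : ℝ), 1 ≤ N → 0 < Z → BoundedBelow st A N Z) {Z : ℝ} (hZ : 0 < Z)
    (hmono : AntitoneOn (fun N : ℕ => energy st A N Z) (Set.Ici 1)) {N : ℕ}
    (hN : N ∈ boundNumbers st A Z) {k : ℝ} (hk : 1 < k) :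
    (N : ℝ) < 2 * Z + 1 +
      (1 / 2) * ((energy st A N Z - energy st A N (k * Z)) / ((N : ℝ) * Z * (k - 1))) := by
  obtain ⟨hN1, ψ, hψ0, hmem⟩ := hN
  obtain ⟨M, rfl⟩ : ∃ M, N = M + 1 := ⟨N - 1, by omega⟩
  rw [hamiltonian_eq_formGraph hA] at hmem
  obtain ⟨u, hψ, hc, hη⟩ := hmem
  set E := energy st A (M + 1) Z with hE
  set E' := energy st A (M + 1) (k * Z) with hE'
  have hb := hfin (M + 1) Z hN1 hZ
  have hb2 := hfin (M + 1) (2 * Z) hN1 (by linarith)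
  have hbk := hfin (M + 1) (k * Z) hN1 (by positivity)
  have hkZ : 0 < (k - 1) * Z := mul_pos (by linarith) hZ
  have hnorm : Tendsto (fun n => ∫ x, ‖(u n : Config (M + 1) → Spin (M + 1)) x‖ ^ 2) atTop
      (𝓝 (‖ψ‖ ^ 2)) := by
    simpa only [norm_sq_toHilbert] using hψ.norm.pow 2
  have hψpos : 0 < ‖ψ‖ ^ 2 := by
    have := norm_pos_iff.2 hψ0
    positivity
  have hform : Tendsto (fun n =>
      (form A Z (u n : Config (M + 1) → Spin (M + 1)) (u n)).re) atTop (𝓝 (E * ‖ψ‖ ^ 2)) := by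
    obtain ⟨c, hlow⟩ := hb
    have h1 := tendsto_form_self (conj_formL hA Z)
      (fun x => by rw [norm_sq_toHilbert]; exact hlow x x.2) hψ hc hη
    have h2 := (Complex.continuous_re.tendsto _).comp h1
    have h3 : (⟪ψ, (E : ℂ) • ψ⟫_ℂ).re = E * ‖ψ‖ ^ 2 := by
      have h4 : ⟪ψ, (E : ℂ) • ψ⟫_ℂ = E * ⟪ψ, ψ⟫_ℂ :=
        inner_smul_right (𝕜 := ℂ) (E := hilbert st (M + 1)) _ _ _
      rw [h4, Complex.re_ofReal_mul]
      congr 1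
      exact inner_self_eq_norm_sq (𝕜 := ℂ) ψ
    rwa [h3] at h2
  set C := (E - E') / ((k - 1) * Z) with hC
  have hatt : ∀ n, ∫ x, attraction x * ‖(u n : Config (M + 1) → Spin (M + 1)) x‖ ^ 2
      ≤ ((form A Z (u n : Config (M + 1) → Spin (M + 1)) (u n)).re
        - E' * ∫ x, ‖(u n : Config (M + 1) → Spin (M + 1)) x‖ ^ 2) / ((k - 1) * Z) := fun n => by
    rw [le_div_iff₀ hkZ, mul_comm]
    exact integral_attraction_le hA hbk (u n).2
  have hattlim : Tendsto (fun n => ((form A Z (u n : Config (M + 1) → Spin (M + 1)) (u n)).re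
        - E' * ∫ x, ‖(u n : Config (M + 1) → Spin (M + 1)) x‖ ^ 2) / ((k - 1) * Z)) atTop
      (𝓝 (C * ‖ψ‖ ^ 2)) := by
    have h1 := (hform.sub (hnorm.const_mul E')).div_const ((k - 1) * Z)
    have h2 : (E * ‖ψ‖ ^ 2 - E' * ‖ψ‖ ^ 2) / ((k - 1) * Z) = C * ‖ψ‖ ^ 2 := by
      rw [hC]; ring
    rwa [h2] at h1
  have hfinal : ((M : ℝ) + 1) * M / 2 < 1 / 4 * C + Z * (M + 1) →
      ((M + 1 : ℕ) : ℝ) < 2 * Z + 1 +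
        (1 / 2) * ((E - E') / (((M + 1 : ℕ) : ℝ) * Z * (k - 1))) := fun h => by
    have hM : (0 : ℝ) < (M : ℝ) + 1 := by positivity
    have h1 : (E - E') / (((M + 1 : ℕ) : ℝ) * Z * (k - 1)) = C / (M + 1) := by
      rw [hC, div_div]
      push_cast
      congr 1
      ring
    have h2 : C / ((M : ℝ) + 1) * (M + 1) = C := div_mul_cancel₀ _ hM.ne'
    rw [h1]
    refine lt_of_mul_lt_mul_right ?_ hM.le
    push_cast
    nlinarith
  apply hfinal
  -- For one particle there is no smaller system to compare with, but the bound is then `0 ≤ C`.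
  rcases Nat.eq_zero_or_pos M with rfl | hMpos
  · have hC0 : 0 ≤ C := by
      have h1 : 0 ≤ C * ‖ψ‖ ^ 2 := ge_of_tendsto' hattlim fun n => (hatt n).trans' <|
        integral_nonneg fun x => mul_nonneg (attraction_nonneg x) (sq_nonneg _)
      exact nonneg_of_mul_nonneg_left h1 hψpos
    simp
    linarith
  have hlow : ∀ v ∈ core st M, E * ∫ x, ‖v x‖ ^ 2 ≤ (form A Z v v).re := fun v hv => by
    refine le_trans ?_ (energy_mul_le hA (hfin M Z hMpos hZ) hv)
    gcongr
    exact hmono (Set.mem_Ici.2 hMpos) (Set.mem_Ici.2 hN1) (Nat.le_succ M)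
  -- The limit along the approximating sequence, at a fixed regularization of `|x|`.
  have hfatou : ∀ n : ℕ, ∫⁻ x, ENNReal.ofReal
      (weightedRepulsion (liebWeight (1 / ((n : ℝ) + 1))) x * ‖(ψ : L2 (M + 1)) x‖ ^ 2)
      ≤ ENNReal.ofReal ((1 / 4 + Z * (1 / ((n : ℝ) + 1))) * (C * ‖ψ‖ ^ 2)
        + Z * (M + 1) * ‖ψ‖ ^ 2) := fun n => by
    have hδ : (0 : ℝ) < 1 / ((n : ℝ) + 1) := by positivity
    have hw := liebWeight_spec hδ
    refine lintegral_mul_norm_sq_le_of_tendsto hψ (weightedRepulsion_nonneg hw.nonneg)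
      (fun m => integrable_weightedRepulsion hw (u m).2)
      (fun m => (integral_weightedRepulsion_le hA hZ.le hw hlow (u m).2).trans
        (add_le_add_left (add_le_add_right
          (mul_le_mul_of_nonneg_left (hatt m) (by positivity)) _) _)) ?_
    have h1 := ((tendsto_re_form_totalWeight_sub hA hZ.le hb hb2 hw hψ hc hη).add
      (hattlim.const_mul (1 / 4 + Z * (1 / ((n : ℝ) + 1))))).add (hnorm.const_mul (Z * (M + 1)))
    simpa only [zero_add] using h1
  have hψ0' : (ψ : L2 (M + 1)) ≠ 0 := fun h => hψ0 (Subtype.ext h)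
  refine lt_of_lintegral_le (measurable_weightedRepulsion continuous_norm) (by positivity)
    (ae_lt_weightedRepulsion hMpos) hψ0' ?_
  have hm : ∀ n : ℕ, AEMeasurable fun x => ENNReal.ofReal
      (weightedRepulsion (liebWeight (1 / ((n : ℝ) + 1))) x * ‖(ψ : L2 (M + 1)) x‖ ^ 2) :=
    fun n => by
      have hw := liebWeight_spec (show (0 : ℝ) < 1 / ((n : ℝ) + 1) by positivity)
      exact ((measurable_weightedRepulsion hw.contDiff.continuous).aemeasurable.mul
        ((Lp.aestronglyMeasurable _).norm.aemeasurable.pow_const 2)).ennreal_ofReal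
  have hlim : ∀ x : Config (M + 1), ENNReal.ofReal
      (weightedRepulsion (fun y => ‖y‖) x * ‖(ψ : L2 (M + 1)) x‖ ^ 2)
      = liminf (fun n : ℕ => ENNReal.ofReal (weightedRepulsion (liebWeight (1 / ((n : ℝ) + 1))) x
        * ‖(ψ : L2 (M + 1)) x‖ ^ 2)) atTop := fun x => by
    have h1 : Tendsto (fun n : ℕ => weightedRepulsion (liebWeight (1 / ((n : ℝ) + 1))) x) atTop
        (𝓝 (weightedRepulsion (fun y => ‖y‖) x)) :=
      tendsto_finsetSum _ fun i _ => (tendsto_liebWeight (x i)).mul_const _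
    exact (ENNReal.tendsto_ofReal (h1.mul_const _)).liminf_eq.symm
  rw [lintegral_congr hlim]
  refine (lintegral_liminf_le' hm).trans ?_
  -- Removing the regularization kills the error `Z δ ⟨∑_i 1 / |x_i|⟩` from `f(x) ≤ |x| + δ`.
  have h2 : Tendsto (fun n : ℕ => ENNReal.ofReal ((1 / 4 + Z * (1 / ((n : ℝ) + 1)))
      * (C * ‖ψ‖ ^ 2) + Z * (M + 1) * ‖ψ‖ ^ 2)) atTop
      (𝓝 (ENNReal.ofReal ((1 / 4 * C + Z * (M + 1)) * ‖(ψ : L2 (M + 1))‖ ^ 2))) := by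
    have h3 := ((((tendsto_one_div_add_atTop_nhds_zero_nat (𝕜 := ℝ)).const_mul Z).const_add
      (1 / 4)).mul_const (C * ‖ψ‖ ^ 2)).add_const (Z * (M + 1) * ‖ψ‖ ^ 2)
    have h4 : (1 / 4 + Z * 0) * (C * ‖ψ‖ ^ 2) + Z * (M + 1) * ‖ψ‖ ^ 2
        = (1 / 4 * C + Z * (M + 1)) * ‖(ψ : L2 (M + 1))‖ ^ 2 := by
      rw [Submodule.coe_norm]; ring
    rw [h4] at h3
    exact ENNReal.tendsto_ofReal h3
  rw [← h2.liminf_eq]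
  exact liminf_le_liminf (Eventually.of_forall hfatou)

theorem bddAbove_boundNumbers (hA : LocallySquareIntegrable A)
    (hfin : ∀ (N : ℕ) (Z : ℝ), 1 ≤ N → 0 < Z → BoundedBelow st A N Z) {Z : ℝ} (hZ : 0 < Z)
    (hmono : AntitoneOn (fun N : ℕ => energy st A N Z) (Set.Ici 1)) :
    BddAbove (boundNumbers st A Z) := by
  obtain ⟨c₁, hc₁⟩ := hfin 1 (2 * Z) le_rfl (by linarith)
  set c := min c₁ 0 with hcdef
  have hc : ∀ v ∈ core st 1, c * ∫ x, ‖v x‖ ^ 2 ≤ (form A (2 * Z) v v).re := fun v hv => by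
    refine le_trans ?_ (hc₁ v hv)
    gcongr
    exact min_le_left _ _
  obtain ⟨B, hB⟩ := exists_nat_ge (2 * Z + 1 + 1 / 2 * ((|energy st A 1 Z| - c) / Z))
  refine ⟨B, fun N hN => ?_⟩
  have h1 := lt_of_mem_boundNumbers hA hfin hZ hmono hN (k := 2) one_lt_two
  have hN1 : 1 ≤ N := hN.1
  obtain ⟨M, rfl⟩ : ∃ M, N = M + 1 := ⟨N - 1, by omega⟩
  have hNpos : (1 : ℝ) ≤ ((M + 1 : ℕ) : ℝ) := by exact_mod_cast hN1
  have h2 : ((M + 1 : ℕ) : ℝ) * c ≤ energy st A (M + 1) (2 * Z) :=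
    le_energy hA (mul_nonpos_of_nonneg_of_nonpos (by positivity) (min_le_right _ _))
      (nbody_lower_bound hA hc M)
  have h3 : energy st A (M + 1) Z ≤ energy st A 1 Z :=
    hmono (Set.mem_Ici.2 le_rfl) (Set.mem_Ici.2 hN1) hN1
  have h4 : energy st A (M + 1) Z - energy st A (M + 1) (2 * Z)
      ≤ ((M + 1 : ℕ) : ℝ) * (|energy st A 1 Z| - c) := by
    have h5 : |energy st A 1 Z| ≤ ((M + 1 : ℕ) : ℝ) * |energy st A 1 Z| :=
      le_mul_of_one_le_left (abs_nonneg _) hNpos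
    linarith [le_abs_self (energy st A 1 Z)]
  have h5 : (energy st A (M + 1) Z - energy st A (M + 1) (2 * Z))
      / (((M + 1 : ℕ) : ℝ) * Z * (2 - 1)) ≤ (|energy st A 1 Z| - c) / Z := by
    rw [div_le_div_iff₀ (by positivity) hZ]
    nlinarith
  have h6 : ((M + 1 : ℕ) : ℝ) ≤ B := by linarith
  exact_mod_cast h6

end Bound

end PauliAtom

end


theorem theorem1 (st : PauliAtom.Statistics) (A : PauliAtom.Space → PauliAtom.Space)
    (hA : PauliAtom.LocallySquareIntegrable A)
    (hfin : ∀ (N : ℕ) (Z : ℝ), 1 ≤ N → 0 < Z → PauliAtom.BoundedBelow st A N Z)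
    (Z : ℝ) (hZ : 0 < Z)
    (hmono : AntitoneOn (fun N : ℕ => PauliAtom.energy st A N Z) (Set.Ici 1)) :
    BddAbove (PauliAtom.boundNumbers st A Z) ∧
    ∀ Nc : ℕ, PauliAtom.IsCriticalNumber st A Z Nc → ∀ k : ℝ, 1 < k →
      (Nc : ℝ) < 2 * Z + 1 +
        (1 / 2) * ((PauliAtom.energy st A Nc Z - PauliAtom.energy st A Nc (k * Z)) /
          ((Nc : ℝ) * Z * (k - 1))) :=
  ⟨PauliAtom.bddAbove_boundNumbers hA hfin hZ hmono, fun _ hNc _ hk =>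
    PauliAtom.lt_of_mem_boundNumbers hA hfin hZ hmono hNc.1 hk⟩
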